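/- **Theorem 1.1.** Conventions. An increasing tableau is a filling of a Young diagram by positive integers whose rows and columns strictly increase and whose set of entries is an initial segment of $\{1,2,\dots\}$. For $n\ge 0$ and $k\ge 0$, $\mathrm{Inc}^{2\times n}_k$ is the set of increasing tableaux of shape $2\times n$ (two rows of length $n$) with maximum value $2n-k$. A small Schröder path of order $n$ is a lattice path from $(0,0)$ to $(2n,0)$ with upsteps $(1,1)$, downsteps $(1,-1)$ and horizontal steps $(2,0)$ that never falls below the horizontal axis and has no horizontal step on the axis; the $n$th small Schröder number is the number of such paths. For $T\in \mathrm{Inc}^{2\times n}_k$, $\mathrm{maj}(T)$ is the sum of all $i$ in the first row of $T$ such that $i+1$ appears in the second row. Finally $[m]_q=1+q+\cdots+q^{m-1}$, $[m]_q!=[1]_q[2]_q\cdots[m]_q$, and $\binom{a}{b}_q=\frac{[a]_q!}{[b]_q!\,[a-b]_q!}$ for $0\le b\le a$. (1) Let $0\le k<n$. The following maps are bijections. * From $\mathrm{Inc}^{2\times n}_k$ to the small Schröder paths of order $n$ with $k$ horizontal steps: $T$ is sent to the path whose $j$th step, for $1\le j\le 2n-k$, is an upstep if $j$ appears only in the first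 row of $T$, a downstep if $j$ appears only in the second row, and a horizontal step if $j$ appears in both rows. * From $\mathrm{Inc}^{2\times n}_k$ to the standard Young tableaux of shape $(n-k,n-k,1^k)$: let $A$ be the set of numbers that appear twice in $T$, and $B$ the set of numbers in the second row of $T$ immediately right of an element of $A$; $T$ is sent to the standard Young tableau whose first row is the first row of $T$ with $A$ deleted, whose second row is the second row of $T$ with $B$ deleted, and whose entries below the first two rows are the elements of $B$. Hence the small Schröder paths of order $n$ with $k$ horizontal steps are also in bijection with the standard Young tableaux of shape $(n-k,n-k,1^k)$, through the inverse of the first map followed by the second. (2) Let $0\le k<n$. Then $$\sum_{T\in \mathrm{Inc}^{2\times n}_k} q^{\mathrm{maj}(T)} = q^{\,n+\binom{k+1}{2}}\;\frac{\binom{n-1}{k}_q\,\binom{2n-k}{n-k-1}_q}{[n-k]_q}.$$ (3) If $k\ge n\ge 1$, then $\mathrm{Inc}^{2\times n}_k$ is empty and there is no small Schröder path of order $n$ with $k$ horizontal steps. (4) For every $n\ge 0$, the total number of increasing tableaux of shape $2\times n$ (over all maximum values) is finite and equals the $n$th small Schröder number. -/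

import Mathlib

/-! ### Increasing tableaux -/

/-- The set of entries of a tableau of shape `μ`. -/
def tabEntries {μ : YoungDiagram} (T : SemistandardYoungTableau μ) : Finset ℕ :=
  μ.cells.image fun c => T c.1 c.2

/-- The maximum value of a tableau (`0` for the empty tableau). -/
def maxValue {μ : YoungDiagram} (T : SemistandardYoungTableau μ) : ℕ :=
  μ.cells.sup fun c => T c.1 c.2

/-- A semistandard tableau (so its columns are strictly increasing) is increasing if its rows are
strictly increasing too and its set of entries is an initial segment of the positive integers. -/
def IsIncreasing {μ : YoungDiagram} (T : SemistandardYoungTableau μ) : Prop :=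
  (∀ i j₁ j₂ : ℕ, j₁ < j₂ → (i, j₂) ∈ μ → T i j₁ < T i j₂) ∧
    ∃ M : ℕ, tabEntries T = Finset.Icc 1 M

/-- The increasing tableaux of shape `μ`. -/
abbrev IncTableau (μ : YoungDiagram) : Type :=
  {T : SemistandardYoungTableau μ // IsIncreasing T}

/-- The increasing tableaux of shape `μ` with maximum value `|μ| - k`. -/
abbrev Inc (μ : YoungDiagram) (k : ℕ) : Type :=
  {T : SemistandardYoungTableau μ // IsIncreasing T ∧ maxValue T + k = μ.card}

/-- The standard Young tableaux of shape `μ`: each of `1, …, |μ|` is the entry of exactly one cell,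
and rows and columns increase (strictly along rows, because the entries are distinct). -/
abbrev SYT (μ : YoungDiagram) : Type :=
  {T : SemistandardYoungTableau μ //
    Set.BijOn (fun c : ℕ × ℕ => T c.1 c.2) (μ.cells : Set (ℕ × ℕ)) (Set.Icc 1 μ.card)}

/-- The set of entries in row `r`; rows are numbered from `0`. -/
def rowEntries {μ : YoungDiagram} (T : SemistandardYoungTableau μ) (r : ℕ) : Finset ℕ :=
  (μ.row r).image fun c => T c.1 c.2

/-- The sum of all `i` in the top row such that `i + 1` appears in the second row. -/
def maj {μ : YoungDiagram} (T : SemistandardYoungTableau μ) : ℕ :=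
  ∑ i ∈ (rowEntries T 0).filter (fun i => i + 1 ∈ rowEntries T 1), i

/-- The rectangle `2 × n`, that is, the partition `(n, n)`. -/
def twoRow (n : ℕ) : YoungDiagram :=
  YoungDiagram.ofRowLens [n, n] (by simp [List.sortedGE_iff_pairwise])

/-- The partition `(n - k, n - k, 1, …, 1)` with `k` ones. -/
def flagShape (n k : ℕ) (h : k < n) : YoungDiagram :=
  YoungDiagram.ofRowLens ((n - k) :: (n - k) :: List.replicate k 1) (by
    have h1 : 1 ≤ n - k := by omega
    simp only [List.sortedGE_iff_pairwise, List.pairwise_cons, List.mem_cons, List.mem_replicate,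
      List.pairwise_replicate]
    refine ⟨?_, ?_, Or.inr le_rfl⟩
    · rintro a (rfl | ⟨-, rfl⟩)
      · exact le_rfl
      · exact h1
    · rintro a ⟨-, rfl⟩
      exact h1)

/-- There are finitely many increasing tableaux of a given shape and maximum value. -/
instance finite_inc (μ : YoungDiagram) (k : ℕ) : Finite (Inc μ k) := by
  let F : Inc μ k → (μ.cells → Fin (μ.card + 1)) := fun T c =>
    ⟨T.1 c.1.1 c.1.2, by
      have h1 : T.1 c.1.1 c.1.2 ≤ maxValue T.1 :=
        Finset.le_sup (f := fun c : ℕ × ℕ => T.1 c.1 c.2) c.2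
      have h2 := T.2.2
      omega⟩
  refine Finite.of_injective F ?_
  intro T T' h
  apply Subtype.ext
  apply SemistandardYoungTableau.ext
  intro i j
  by_cases hc : (i, j) ∈ μ
  · exact congrArg Fin.val (congrFun h ⟨(i, j), hc⟩)
  · rw [T.1.zeros hc, T'.1.zeros hc]

noncomputable instance fintype_inc (μ : YoungDiagram) (k : ℕ) : Fintype (Inc μ k) :=
  Fintype.ofFinite _

/-! ### Small Schröder paths -/

/-- The three types of line segment of a Schröder path. -/
inductive PathStep where
  | up : PathStep
  | down : PathStep
  | horizontal : PathStep
  deriving DecidableEq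

/-- The displacement of a segment. -/
def PathStep.vec : PathStep → ℤ × ℤ
  | .up => (1, 1)
  | .down => (1, -1)
  | .horizontal => (2, 0)

/-- The point reached from the origin after the first `i` segments. -/
def pathPoint (p : List PathStep) (i : ℕ) : ℤ × ℤ :=
  ((p.take i).map PathStep.vec).sum

/-- The path from the origin with list of segments `p` is a small Schröder path to `(2n, 0)`: it
ends there, never falls below the horizontal axis (segments are straight, so it suffices to look at
the points between them), and has no horizontal segment on the axis. -/
structure IsSmallSchroder (n : ℕ) (p : List PathStep) : Prop where
  ends : pathPoint p p.length = (2 * (n : ℤ), 0)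
  nonneg : ∀ i ≤ p.length, 0 ≤ (pathPoint p i).2
  off_axis : ∀ i < p.length, p[i]? = some PathStep.horizontal → (pathPoint p i).2 ≠ 0

/-- The small Schröder paths from the origin to `(2n, 0)`. -/
abbrev SchroderPath (n : ℕ) : Type := {p : List PathStep // IsSmallSchroder n p}

/-- The small Schröder paths from the origin to `(2n, 0)` with `k` horizontal steps. -/
abbrev SchroderPathWith (n k : ℕ) : Type :=
  {p : List PathStep // IsSmallSchroder n p ∧ p.count PathStep.horizontal = k}

/-- The `n`th small Schröder number, defined as the number of small Schröder paths to `(2n, 0)`. -/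
noncomputable def schroderNumber (n : ℕ) : ℕ := Nat.card (SchroderPath n)

/-! ### The data of the explicit bijections -/

/-- The type of the `j`th segment of the path of a two-row tableau in which `j` appears: horizontal
if `j` is in both rows, an upstep if it is only in the first, a downstep if only in the second. -/
def segmentOf {μ : YoungDiagram} (T : SemistandardYoungTableau μ) (j : ℕ) : PathStep :=
  if j ∈ rowEntries T 0 then
    if j ∈ rowEntries T 1 then PathStep.horizontal else PathStep.up
  else PathStep.down

/-- The segments of the path of a two-row tableau, for `j = 1, 2, …, M` with `M` the maximum
value of the tableau. -/
def segments {μ : YoungDiagram} (T : SemistandardYoungTableau μ) : List PathStep :=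
  (List.range' 1 (maxValue T)).map (segmentOf T)

/-- The set `A` of numbers that appear twice in a two-row increasing tableau. -/
def doubled {μ : YoungDiagram} (T : SemistandardYoungTableau μ) : Finset ℕ :=
  rowEntries T 0 ∩ rowEntries T 1

/-- The set `B` of numbers that appear in the second row immediately right of an element of `A`. -/
def rightOfDoubled {μ : YoungDiagram} (T : SemistandardYoungTableau μ) : Finset ℕ :=
  ((μ.row 1).filter fun c => 1 ≤ c.2 ∧ T 1 (c.2 - 1) ∈ doubled T).image fun c => T c.1 c.2

/-- The set of entries of a tableau below its first two rows. -/
def lowerEntries {μ : YoungDiagram} (T : SemistandardYoungTableau μ) : Finset ℕ :=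
  (μ.cells.filter fun c => 2 ≤ c.1).image fun c => T c.1 c.2

/-- `S` arises from the two-row tableau `T` by deleting `A` from the first row and `B` from the
second row, and appending `B` to the first column. A standard tableau of shape
`(n - k, n - k, 1, …, 1)` is determined by its sets of entries in these three regions. -/
def IsFlagOf {μ ν : YoungDiagram} (T : SemistandardYoungTableau μ)
    (S : SemistandardYoungTableau ν) : Prop :=
  rowEntries S 0 = rowEntries T 0 \ doubled T ∧
    rowEntries S 1 = rowEntries T 1 \ rightOfDoubled T ∧
    lowerEntries S = rightOfDoubled T

/-! ### `q`-analogues, in the field of rational functions of `q` -/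

/-- `[m]_q = 1 + q + ⋯ + q ^ (m - 1)`. -/
noncomputable def qNum (m : ℕ) : RatFunc ℚ := ∑ i ∈ Finset.range m, RatFunc.X ^ i

/-- `[m]_q! = [1]_q [2]_q ⋯ [m]_q`. -/
noncomputable def qFact (m : ℕ) : RatFunc ℚ := ∏ i ∈ Finset.range m, qNum (i + 1)

/-- The `q`-binomial coefficient, which is `0` for `b > a`. -/
noncomputable def qBinom (a b : ℕ) : RatFunc ℚ :=
  if b ≤ a then qFact a / (qFact b * qFact (a - b)) else 0

/-! ### `q`-numbers and the `q`-hook formula for the shape `(a, b, 1, …, 1)` -/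

/-! An increasing tableau with two rows is the pair of its row sets `R`, `S`. Strict columns mean
that every `x ∈ S` has more elements of `R` below it than elements of `S`. Numbers in both rows
cancel from this comparison. On the path it therefore says that every step other than an upstep
starts at positive height, and this is what the definition of a small Schröder path amounts to
(`isSmallSchroder_iff`, `isRowPair_iff`). The path has `n - k` upsteps, so it must be empty if `k ≥
n`.

For the flags, the last element of `S` is not in `A = R ∩ S` (`IsRowPair.nth_notMem`). So passing to
the right neighbour in `S` is a bijection from `A` to `B`, and `A` is recovered from `B` and `S` by
passing to left neighbours. Below an `x ∈ S` there are as many elements of `A` as of `B`, plus one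
if `x ∈ B` (`count_eq_count_rightOf`). Deleting `A` from `R` and `B` from `S` thus keeps the strict
comparison at the elements of `S \ B`, and at the elements of `B` it leaves a weak comparison, which
follows from the strict one.

The major index is summed over paths. A number `i` counts when step `i` is not a downstep and step
`i + 1` is not an upstep. Partial paths with `u` upsteps, `d` downsteps and `h` horizontal steps are
split according to whether the last step that is not an upstep is horizontal. In that case the last
doubled number has no right neighbour, so `B` is one smaller than `A`, and the expected shape is
`(u, d + 1, 1, …, 1)` with `h - 1` ones; otherwise it is `(u, d, 1, …, 1)` with `h` ones. Removing
the last step yields the recursion satisfied by the `q`-hook expressions of these shapes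
(`flagGF_rec_zero`, `flagGF_rec_succ`), which proves `pathGF_eq_flagGF`. For paths that return to
the axis the horizontal class is empty. -/

theorem qNum_mul_sub (m : ℕ) : qNum m * (RatFunc.X - 1) = RatFunc.X ^ m - 1 :=
  geom_sum_mul _ _

theorem ratFunc_X_pow_sub_one_ne_zero (m : ℕ) : (RatFunc.X : RatFunc ℚ) ^ (m + 1) - 1 ≠ 0 := by
  have h : (algebraMap (Polynomial ℚ) (RatFunc ℚ)) (Polynomial.X ^ (m + 1) - 1) ≠ 0 := by
    rw [Ne, FaithfulSMul.algebraMap_eq_zero_iff]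
    exact Polynomial.X_pow_sub_C_ne_zero (Nat.succ_pos m) 1
  simpa using h

theorem ratFunc_X_sub_one_ne_zero : (RatFunc.X : RatFunc ℚ) - 1 ≠ 0 := by
  simpa using ratFunc_X_pow_sub_one_ne_zero 0

theorem qNum_eq (m : ℕ) : qNum m = (RatFunc.X ^ m - 1) / (RatFunc.X - 1) :=
  eq_div_of_mul_eq ratFunc_X_sub_one_ne_zero (qNum_mul_sub m)

theorem qNum_succ_ne_zero (m : ℕ) : qNum (m + 1) ≠ 0 := by
  rw [qNum_eq]
  exact div_ne_zero (ratFunc_X_pow_sub_one_ne_zero m) ratFunc_X_sub_one_ne_zero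

@[simp] theorem qNum_one : qNum 1 = 1 := by simp [qNum]

@[simp] theorem qFact_zero : qFact 0 = 1 := by simp [qFact]

theorem qFact_succ (m : ℕ) : qFact (m + 1) = qFact m * qNum (m + 1) :=
  Finset.prod_range_succ _ _

theorem qFact_ne_zero (m : ℕ) : qFact m ≠ 0 :=
  Finset.prod_ne_zero_iff.2 fun i _ => qNum_succ_ne_zero i

/-- The `q`-hook formula for the generating function of the major index over standard Young
tableaux of shape `(a, b, 1, …, 1)` with `c` ones. -/
noncomputable def flagGF (a b c : ℕ) : RatFunc ℚ :=
  if b = 0 then if c = 0 then 1 else 0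
  -- The exponent is the sum over the cells of their row index, counted from `0`. The hooks at the
  -- heads of the first two rows are `a + c + 1` and `b + c`. The other hooks of these rows multiply
  -- to `[a]! / [a + 1 - b]` and `[b]! / [b]`, and those below to `[c]!`.
  else RatFunc.X ^ (b + c + (c + 1).choose 2) *
    (qFact (a + b + c) * qNum (a + 1 - b) * qNum b /
      (qNum (a + c + 1) * qNum (b + c) * (qFact a * qFact b * qFact c)))

theorem flagGF_zero (a c : ℕ) : flagGF a 0 c = if c = 0 then 1 else 0 := by simp [flagGF]

theorem flagGF_eq_zero {a b : ℕ} (h : a < b) (c : ℕ) : flagGF a b c = 0 := by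
  have h1 : b ≠ 0 := by omega
  have h2 : a + 1 - b = 0 := by omega
  simp [flagGF, h1, h2, qNum]

theorem flagGF_succ (a b c : ℕ) : flagGF a (b + 1) c =
    RatFunc.X ^ (b + 1 + c + (c + 1).choose 2) *
      (qFact (a + b + c + 1) * qNum (a - b) / (qNum (a + c + 1) * qNum (b + c + 1) *
        (qFact a * qFact b * qFact c))) := by
  have h1 := qFact_ne_zero a
  have h2 := qFact_ne_zero b
  have h3 := qFact_ne_zero c
  have h4 := qNum_succ_ne_zero b
  have h5 := qNum_succ_ne_zero (a + c)
  have h6 := qNum_succ_ne_zero (b + c)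
  rw [flagGF, if_neg (Nat.succ_ne_zero b), qFact_succ b, Nat.add_sub_add_right,
    show a + (b + 1) + c = a + b + c + 1 by ring, show b + 1 + c = b + c + 1 by ring]
  field_simp

/-- The indices enter through equations so that all terms of the recursion can be put over common
successor forms, with `a - b` free of truncated subtraction. -/
theorem flagGF_succ_of_eq {a b c m d p r : ℕ} (hm : a + b + c + 1 = m) (hd : a = b + d)
    (hp : a + c + 1 = p) (hr : b + c + 1 = r) : flagGF a (b + 1) c =
    RatFunc.X ^ (r + (c + 1).choose 2) *
      (qFact m * qNum d / (qNum p * qNum r * (qFact a * qFact b * qFact c))) := by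
  rw [flagGF_succ, hm, show a - b = d by omega, hp, hr, show b + 1 + c = r by omega]

theorem qNum_eq_mul (m : ℕ) : qNum m = (RatFunc.X ^ m - 1) * (RatFunc.X - 1)⁻¹ := by
  rw [qNum_eq, div_eq_mul_inv]

/-- The recursion of the major index generating function along the corner of the largest entry. -/
theorem flagGF_rec_zero {a b : ℕ} (h : b ≤ a) :
    flagGF (a + 1) (b + 1) 0 = flagGF a (b + 1) 0 + (flagGF (a + 1) b 0 - flagGF a b 0) +
      RatFunc.X ^ (a + 1 + b + 0) * flagGF a b 0 := by
  obtain ⟨e, he⟩ := Nat.exists_eq_add_of_le h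
  have fa := qFact_ne_zero a
  have N1 := qNum_succ_ne_zero a
  have N2 := qNum_succ_ne_zero (a + 1)
  rcases b with _ | b
  · simp only [flagGF_succ, flagGF_zero, if_true, qFact_succ, qFact_zero, zero_add, add_zero,
      Nat.sub_zero, qNum_one, mul_one] at *
    field_simp
    simp only [qNum_eq_mul, Nat.choose_eq_zero_of_lt one_lt_two]
    -- Since `[1]` has been replaced by `1`, the identity is no longer homogeneous in the
    -- `q`-numbers, and the powers of `X - 1` must be cleared.
    have := ratFunc_X_sub_one_ne_zero
    field_simp
    ring
  · have fb := qFact_ne_zero b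
    have fm := qFact_ne_zero (a + b)
    have N0 := qNum_succ_ne_zero (b + 1)
    have N3 := qNum_succ_ne_zero (a + b)
    have N4 := qNum_succ_ne_zero (a + b + 1)
    have N5 := qNum_succ_ne_zero b
    rw [flagGF_succ_of_eq (a := a + 1) (b := b + 1) (c := 0) (m := a + b + 1 + 1 + 1)
        (d := e + 1) (p := a + 1 + 1) (r := b + 1 + 1) (by omega) (by omega) (by omega) (by omega),
      flagGF_succ_of_eq (a := a) (b := b + 1) (c := 0) (m := a + b + 1 + 1)
        (d := e) (p := a + 1) (r := b + 1 + 1) (by omega) (by omega) (by omega) (by omega),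
      flagGF_succ_of_eq (a := a + 1) (b := b) (c := 0) (m := a + b + 1 + 1)
        (d := e + 2) (p := a + 1 + 1) (r := b + 1) (by omega) (by omega) (by omega) (by omega),
      flagGF_succ_of_eq (a := a) (b := b) (c := 0) (m := a + b + 1)
        (d := e + 1) (p := a + 1) (r := b + 1) (by omega) (by omega) (by omega) (by omega)]
    simp only [qFact_succ, qFact_zero]
    field_simp
    simp only [qNum_eq_mul, he]
    ring

/-- In terms of standard tableaux, the largest entry `N` lies at the end of the first row (no
descent at `N - 1`), at the end of the second row (a descent exactly if `N - 1` ends the first row),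
or at the foot of the column (always a descent). The exponent is `N - 1`. The proof only checks the
identity of rational functions. -/
theorem flagGF_rec_succ {a b : ℕ} (h : b ≤ a) (c : ℕ) :
    flagGF (a + 1) (b + 1) (c + 1) = flagGF a (b + 1) (c + 1) +
      (flagGF (a + 1) b (c + 1) - flagGF a b (c + 1)) +
      RatFunc.X ^ (a + 1 + b + (c + 1)) * (flagGF a b (c + 1) + flagGF (a + 1) (b + 1) c) := by
  obtain ⟨e, he⟩ := Nat.exists_eq_add_of_le h
  have c1 : (c + 1 + 1).choose 2 = (c + 1).choose 2 + (c + 1) := by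
    rw [Nat.choose_succ_succ' (c + 1) 1, Nat.choose_one_right, add_comm]
  have fa := qFact_ne_zero a
  have fc := qFact_ne_zero c
  have N0 := qNum_succ_ne_zero c
  have N1 := qNum_succ_ne_zero a
  rcases b with _ | b
  · have fm := qFact_ne_zero (a + c)
    have N3 := qNum_succ_ne_zero (a + c)
    have N4 := qNum_succ_ne_zero (a + c + 1)
    have N5 := qNum_succ_ne_zero (a + c + 1 + 1)
    have N6 := qNum_succ_ne_zero (c + 1)
    simp only [flagGF_succ, flagGF_zero, Nat.succ_ne_zero, if_false, c1, zero_add, add_zero,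
      Nat.sub_zero, show a + 1 + (c + 1) = a + c + 1 + 1 by ring,
      show a + 1 + c = a + c + 1 by ring, show a + (c + 1) = a + c + 1 by ring, qFact_succ,
      qFact_zero, mul_one]
    field_simp
    simp only [qNum_eq_mul, he]
    ring
  · have fb := qFact_ne_zero b
    have fm := qFact_ne_zero (a + b + c + 1)
    have N2 := qNum_succ_ne_zero b
    have N3 := qNum_succ_ne_zero (b + c + 1)
    have N4 := qNum_succ_ne_zero (b + c + 1 + 1)
    have N5 := qNum_succ_ne_zero (b + 1)
    have N6 := qNum_succ_ne_zero (a + c)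
    have N7 := qNum_succ_ne_zero (a + c + 1)
    have N8 := qNum_succ_ne_zero (a + c + 1 + 1)
    rw [flagGF_succ_of_eq (a := a + 1) (b := b + 1) (c := c + 1) (m := a + b + c + 1 + 1 + 1 + 1)
        (d := e + 1) (p := a + c + 1 + 1 + 1) (r := b + c + 1 + 1 + 1)
        (by omega) (by omega) (by omega) (by omega),
      flagGF_succ_of_eq (a := a) (b := b + 1) (c := c + 1) (m := a + b + c + 1 + 1 + 1)
        (d := e) (p := a + c + 1 + 1) (r := b + c + 1 + 1 + 1)
        (by omega) (by omega) (by omega) (by omega),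
      flagGF_succ_of_eq (a := a + 1) (b := b) (c := c + 1) (m := a + b + c + 1 + 1 + 1)
        (d := e + 2) (p := a + c + 1 + 1 + 1) (r := b + c + 1 + 1)
        (by omega) (by omega) (by omega) (by omega),
      flagGF_succ_of_eq (a := a) (b := b) (c := c + 1) (m := a + b + c + 1 + 1)
        (d := e + 1) (p := a + c + 1 + 1) (r := b + c + 1 + 1)
        (by omega) (by omega) (by omega) (by omega),
      flagGF_succ_of_eq (a := a + 1) (b := b + 1) (c := c) (m := a + b + c + 1 + 1 + 1)
        (d := e + 1) (p := a + c + 1 + 1) (r := b + c + 1 + 1)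
        (by omega) (by omega) (by omega) (by omega), c1]
    simp only [qFact_succ]
    field_simp
    simp only [qNum_eq_mul, he]
    ring

theorem flagGF_square {n k : ℕ} (h : k < n) : flagGF (n - k) (n - k) k =
    RatFunc.X ^ (n + (k + 1).choose 2) *
      (qBinom (n - 1) k * qBinom (2 * n - k) (n - k - 1) / qNum (n - k)) := by
  obtain ⟨m, rfl⟩ := Nat.exists_eq_add_of_lt h
  have h1 := qFact_ne_zero m
  have h2 := qFact_ne_zero k
  have h3 := qFact_ne_zero (k + m)
  have h4 := qNum_succ_ne_zero m
  have h5 := qNum_succ_ne_zero (k + m)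
  have h6 := qNum_succ_ne_zero (k + m + 1)
  rw [show k + m + 1 - k = m + 1 by omega, Nat.add_sub_cancel, Nat.add_sub_cancel,
    flagGF_succ_of_eq (m := 2 * (k + m + 1) - k) (d := 1) (p := k + m + 1 + 1) (r := k + m + 1)
      (by omega) (by omega) (by omega) (by omega),
    qBinom, if_pos (by omega), qBinom, if_pos (by omega), Nat.add_sub_cancel_left,
    show 2 * (k + m + 1) - k - m = k + m + 1 + 1 by omega]
  simp only [qFact_succ, qNum_one]
  field_simp

/-! ### Weighted enumeration of partial small Schröder paths

Partial paths are lists of segments whose head is the last segment. -/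

open PathStep

instance : Fintype PathStep := ⟨{up, down, horizontal}, fun s => by cases s <;> decide⟩

/-- The lists of segments of a given length. -/
def stepWords : ℕ → Finset (List PathStep)
  | 0 => {[]}
  | m + 1 => (Finset.univ ×ˢ stepWords m).image fun x => x.1 :: x.2

theorem mem_stepWords {m : ℕ} {p : List PathStep} : p ∈ stepWords m ↔ p.length = m := by
  induction m generalizing p with
  | zero => simp [stepWords]
  | succ m ih =>
    cases p with
    | nil => simp [stepWords]
    | cons s p => simp [stepWords, ih]

theorem sum_stepWords_succ {M : Type*} [AddCommMonoid M] (m : ℕ) (φ : List PathStep → M) :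
    ∑ p ∈ stepWords (m + 1), φ p =
      ∑ p ∈ stepWords m, φ (up :: p) + ∑ p ∈ stepWords m, φ (down :: p) +
        ∑ p ∈ stepWords m, φ (horizontal :: p) := by
  rw [stepWords, Finset.sum_image, Finset.sum_product]
  · change ∑ s ∈ ({up, down, horizontal} : Finset PathStep), _ = _
    simp [add_assoc]
  · rintro ⟨s, p⟩ - ⟨s', p'⟩ - h
    simpa using h

/-- A partial path (with its last segment first) stays on or above the axis and has no horizontal
segment on the axis. -/
def StaysAbove : List PathStep → Prop
  | [] => True
  | s :: p => StaysAbove p ∧ (s = up ∨ p.count down < p.count up)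

/-- The major index of a partial path (with its last segment first). -/
def pathMaj : List PathStep → ℕ
  | [] => 0
  -- `p.length` is the position of the segment before `s`. If `p` is empty, the summand is `0` in
  -- either case.
  | s :: p => pathMaj p + if s ≠ up ∧ p.head? ≠ some down then p.length else 0

/-- Whether the last segment of a partial path that is not an upstep is horizontal. -/
def EndsHorizontal : List PathStep → Prop
  | [] => False
  | up :: p => EndsHorizontal p
  | down :: _ => False
  | horizontal :: _ => True

/-- A partial path with `u` upsteps, `d` downsteps and `h` horizontal steps. -/
structure IsPartialPath (u d h : ℕ) (p : List PathStep) : Prop where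
  staysAbove : StaysAbove p
  up : p.count up = u
  down : p.count down = d
  horizontal : p.count horizontal = h

theorem IsPartialPath.length {u d h : ℕ} {p : List PathStep} (hp : IsPartialPath u d h p) :
    p.length = u + d + h := by
  rw [← hp.up, ← hp.down, ← hp.horizontal]
  clear hp
  induction p with
  | nil => rfl
  | cons s p ih => cases s <;> simp <;> omega

theorem isPartialPath_up {u d h : ℕ} {p : List PathStep} :
    IsPartialPath (u + 1) d h (up :: p) ↔ IsPartialPath u d h p := by
  constructor
  · rintro ⟨h1, h2, h3, h4⟩
    exact ⟨h1.1, by simpa using h2, by simpa using h3, by simpa using h4⟩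
  · rintro ⟨h1, h2, h3, h4⟩
    exact ⟨⟨h1, Or.inl rfl⟩, by simpa using h2, by simpa using h3, by simpa using h4⟩

theorem isPartialPath_down {u d h : ℕ} {p : List PathStep} :
    IsPartialPath u (d + 1) h (down :: p) ↔ d < u ∧ IsPartialPath u d h p := by
  constructor
  · rintro ⟨⟨h0, h1⟩, h2, h3, h4⟩
    simp at h1 h2 h3 h4
    exact ⟨by omega, h0, h2, h3, h4⟩
  · rintro ⟨h0, h1, rfl, rfl, h4⟩
    exact ⟨⟨h1, Or.inr h0⟩, by simp, by simp, by simpa using h4⟩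

theorem isPartialPath_horizontal {u d h : ℕ} {p : List PathStep} :
    IsPartialPath u d (h + 1) (horizontal :: p) ↔ d < u ∧ IsPartialPath u d h p := by
  constructor
  · rintro ⟨⟨h0, h1⟩, h2, h3, h4⟩
    simp at h1 h2 h3 h4
    exact ⟨by omega, h0, h2, h3, h4⟩
  · rintro ⟨h0, h1, rfl, rfl, h4⟩
    exact ⟨⟨h1, Or.inr h0⟩, by simp, by simp, by simpa using h4⟩

open Classical in
/-- The major index generating function of the partial paths with `u` upsteps, `d` downsteps and
`h` horizontal steps that satisfy `P`. -/
noncomputable def pathGF (P : List PathStep → Prop) (u d h : ℕ) : RatFunc ℚ :=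
  ∑ p ∈ stepWords (u + d + h),
    if IsPartialPath u d h p ∧ P p then RatFunc.X ^ pathMaj p else 0

/-! ### Splitting the generating function by the last step -/

theorem pathGF_add {P Q R : List PathStep → Prop} (hP : ∀ p, P p ↔ Q p ∨ R p)
    (hQ : ∀ p, Q p → ¬ R p) (u d h : ℕ) : pathGF P u d h = pathGF Q u d h + pathGF R u d h := by
  rw [pathGF, pathGF, pathGF, ← Finset.sum_add_distrib]
  refine Finset.sum_congr rfl fun p _ => ?_
  by_cases h1 : IsPartialPath u d h p
  · by_cases h2 : Q p
    · simp [h1, h2, hP, hQ p h2]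
    · by_cases h3 : R p <;> simp [h1, h2, h3, hP]
  · simp [h1]

theorem pathGF_eq_zero {P : List PathStep → Prop} {u d h : ℕ}
    (H : ∀ p, IsPartialPath u d h p → ¬ P p) : pathGF P u d h = 0 := by
  refine Finset.sum_eq_zero fun p _ => if_neg ?_
  rintro ⟨h1, h2⟩
  exact H p h1 h2

theorem pathGF_congr {P Q : List PathStep → Prop} {u d h : ℕ}
    (H : ∀ p, IsPartialPath u d h p → (P p ↔ Q p)) : pathGF P u d h = pathGF Q u d h := by
  classical exact Finset.sum_congr rfl fun p _ => if_congr (and_congr_right (H p)) rfl rfl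

/-- Removing a last upstep. -/
theorem pathGF_up {P Q : List PathStep → Prop} (hP : ∀ p, P (up :: p) ↔ Q p) (u d h : ℕ) :
    pathGF (fun p => p.head? = some up ∧ P p) (u + 1) d h = pathGF Q u d h := by
  rw [pathGF, show u + 1 + d + h = (u + d + h) + 1 by ring, sum_stepWords_succ,
    add_assoc]
  refine (add_eq_left.2 ?_).trans ?_
  · rw [Finset.sum_eq_zero fun p _ => if_neg (by simp), zero_add,
      Finset.sum_eq_zero fun p _ => if_neg (by simp)]
  · refine Finset.sum_congr rfl fun p _ => ?_
    congr 1
    simp [isPartialPath_up, hP]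

/-- Downsteps and horizontal steps are appended under the same condition `d < u` and with the same
weight: the number of earlier steps is added unless the preceding step is a downstep. This common
right-hand side is why the two classes of paths share a recursion. -/
theorem sum_stepWords_cons {s : PathStep} (hs : s ≠ up) {u d h d' h' : ℕ}
    (H : ∀ p, IsPartialPath u d' h' (s :: p) ↔ d < u ∧ IsPartialPath u d h p) (hd : d < u) :
    (open Classical in ∑ p ∈ stepWords (u + d + h),
      if IsPartialPath u d' h' (s :: p) then (RatFunc.X : RatFunc ℚ) ^ pathMaj (s :: p) else 0) =
      pathGF (fun p => p.head? = some down) u d h +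
        RatFunc.X ^ (u + d + h) * pathGF (fun p => p.head? ≠ some down) u d h := by
  rw [pathGF, pathGF, Finset.mul_sum, ← Finset.sum_add_distrib]
  refine Finset.sum_congr rfl fun p hp => ?_
  rw [mem_stepWords] at hp
  by_cases h1 : IsPartialPath u d h p
  · by_cases h2 : p.head? = some down <;>
      simp [H, hd, h1, h2, pathMaj, hs, hp, pow_add, mul_comm]
  · simp [H, h1]

/-- Removing a last downstep. -/
theorem pathGF_down {u d : ℕ} (hd : d < u) (h : ℕ) :
    pathGF (fun p => p.head? = some down) u (d + 1) h =
      pathGF (fun p => p.head? = some down) u d h +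
        RatFunc.X ^ (u + d + h) * pathGF (fun p => p.head? ≠ some down) u d h := by
  rw [← sum_stepWords_cons (s := down) (by decide) (fun p => isPartialPath_down) hd,
    pathGF, show u + (d + 1) + h = (u + d + h) + 1 by ring, sum_stepWords_succ,
    Finset.sum_eq_zero fun p _ => if_neg (by simp), zero_add,
    add_eq_left.2 (Finset.sum_eq_zero fun p _ => if_neg (by simp))]
  refine Finset.sum_congr rfl fun p _ => ?_
  congr 1
  simp

/-- Removing a last horizontal step. -/
theorem pathGF_horizontal {u d : ℕ} (hd : d < u) (h : ℕ) :
    pathGF (fun p => p.head? = some horizontal) u d (h + 1) =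
      pathGF (fun p => p.head? = some down) u d h +
        RatFunc.X ^ (u + d + h) * pathGF (fun p => p.head? ≠ some down) u d h := by
  rw [← sum_stepWords_cons (s := horizontal) (by decide) (fun p => isPartialPath_horizontal) hd,
    pathGF, show u + d + (h + 1) = (u + d + h) + 1 by ring, sum_stepWords_succ,
    Finset.sum_eq_zero fun p _ => if_neg (by simp), zero_add,
    add_eq_right.2 (Finset.sum_eq_zero fun p _ => if_neg (by simp))]
  refine Finset.sum_congr rfl fun p _ => ?_
  congr 1
  simp

theorem StaysAbove.count_le {p : List PathStep} (hp : StaysAbove p) :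
    p.count down ≤ p.count up := by
  induction p with
  | nil => simp
  | cons s p ih =>
    have := ih hp.1
    have := hp.2
    cases s <;> simp at * <;> omega

theorem StaysAbove.eq_nil {p : List PathStep} (hp : StaysAbove p) (h : p.count up = 0) :
    p = [] := by
  induction p with
  | nil => rfl
  | cons s p ih =>
    obtain ⟨h1, h2⟩ := hp
    cases s
    · simp at h
    · simp at h h2; omega
    · simp at h h2; omega

theorem EndsHorizontal.mem {p : List PathStep} (hp : EndsHorizontal p) : horizontal ∈ p := by
  induction p with
  | nil => exact hp.elim
  | cons s p ih =>
    cases s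
    · exact List.mem_cons_of_mem _ (ih hp)
    · exact hp.elim
    · exact List.mem_cons_self

theorem endsHorizontal_iff (p : List PathStep) :
    EndsHorizontal p ↔ p.head? = some up ∧ EndsHorizontal p ∨ p.head? = some horizontal := by
  cases p with
  | nil => simp [EndsHorizontal]
  | cons s p => cases s <;> simp [EndsHorizontal]

theorem pathGF_endsHorizontal_zero (u d : ℕ) : pathGF EndsHorizontal u d 0 = 0 := by
  refine pathGF_eq_zero fun p hp h => ?_
  exact List.count_eq_zero.1 hp.horizontal h.mem

/-- The assumption `u ≠ 0` excludes the empty path, which does not end horizontally but has no last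
step. -/
theorem pathGF_ends (u d h : ℕ) (hu : u ≠ 0) :
    pathGF (fun p => ¬ EndsHorizontal p) u d h =
      pathGF (fun p => p.head? = some up ∧ ¬ EndsHorizontal p) u d h +
        pathGF (fun p => p.head? = some down) u d h := by
  rw [← pathGF_add (fun p => Iff.rfl) (by rintro p ⟨h1, -⟩ h2; simp [h1] at h2)]
  refine pathGF_congr fun p hp => ?_
  have := hp.up
  cases p with
  | nil => simp at this; omega
  | cons s p => cases s <;> simp [EndsHorizontal]

/-- The partial paths whose last segment that is not an upstep is not horizontal are equidistributed
with the standard tableaux of shape `(u, d, 1, …, 1)`; those for which it is horizontal, with the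
tableaux of the shape with one more cell in its second row and one fewer in its first column. -/
theorem pathGF_eq_flagGF (m : ℕ) : ∀ u d h : ℕ,
    (u + d + h = m → pathGF (fun p => ¬ EndsHorizontal p) u d h = flagGF u d h) ∧
      (u + d + h + 1 = m → pathGF EndsHorizontal u d (h + 1) = flagGF u (d + 1) h) := by
  induction m using Nat.strong_induction_on with
  | _ m ih =>
  -- This is the contribution of the paths whose last step is a downstep or, equally, a horizontal
  -- step. By induction, the paths ending with a downstep give the difference of hook expressions in
  -- the recursion. The paths ending otherwise give the bracket that is multiplied by the power of
  -- `q`.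
  have step : ∀ u d h : ℕ, d ≤ u → u + d + h + 2 = m →
      pathGF (fun p => p.head? = some down) (u + 1) d h +
        RatFunc.X ^ (u + 1 + d + h) * pathGF (fun p => p.head? ≠ some down) (u + 1) d h =
      flagGF (u + 1) (d + 1) h - flagGF u (d + 1) h := by
    intro u d h hd hm
    have h1 := pathGF_ends (u + 1) d h (Nat.succ_ne_zero _)
    rw [pathGF_up (Q := fun p => ¬ EndsHorizontal p) (fun p => Iff.rfl),
      (ih (u + 1 + d + h) (by omega) _ _ _).1 rfl, (ih (u + d + h) (by omega) _ _ _).1 rfl] at h1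
    have h2 : pathGF (fun p => p.head? ≠ some down) (u + 1) d h =
        pathGF (fun p => p.head? = some up ∧ ¬ EndsHorizontal p) (u + 1) d h +
          pathGF EndsHorizontal (u + 1) d h := by
      rw [← pathGF_add (fun p => Iff.rfl) (by rintro p ⟨-, h1⟩ h2; exact h1 h2)]
      refine pathGF_congr fun p hp => ?_
      have := hp.up
      cases p with
      | nil => simp at this
      | cons s p => cases s <;> simp [EndsHorizontal, em']
    rw [pathGF_up (Q := fun p => ¬ EndsHorizontal p) (fun p => Iff.rfl),
      (ih (u + d + h) (by omega) _ _ _).1 rfl] at h2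
    rw [h2]
    rcases h with _ | h
    · rw [pathGF_endsHorizontal_zero, flagGF_rec_zero hd]
      linear_combination -h1
    · rw [(ih (u + 1 + d + h + 1) (by omega) _ _ _).2 rfl, flagGF_rec_succ hd]
      linear_combination -h1
  intro u d h
  constructor
  · intro hm
    rcases u with _ | u
    · rcases Nat.eq_zero_or_pos (d + h) with h0 | h0
      · obtain ⟨rfl, rfl⟩ : d = 0 ∧ h = 0 := by omega
        rw [flagGF_zero, if_pos rfl, pathGF]
        simp only [stepWords, Finset.sum_singleton]
        rw [if_pos ⟨⟨trivial, rfl, rfl, rfl⟩, id⟩, pathMaj, pow_zero]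
      · have : flagGF 0 d h = 0 := by
          rcases d with _ | d
          · rw [flagGF_zero, if_neg (by omega)]
          · exact flagGF_eq_zero (by omega) _
        rw [this]
        refine pathGF_eq_zero fun p hp _ => ?_
        have h1 := hp.length
        rw [hp.staysAbove.eq_nil hp.up] at h1
        simp at h1
        omega
    · rw [pathGF_ends _ _ _ (Nat.succ_ne_zero _),
        pathGF_up (Q := fun p => ¬ EndsHorizontal p) (fun p => Iff.rfl),
        (ih (u + d + h) (by omega) _ _ _).1 rfl]
      rcases d with _ | d
      · rw [pathGF_eq_zero (P := fun p => p.head? = some down), flagGF_zero, flagGF_zero, add_zero]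
        intro p hp h1
        exact List.count_eq_zero.1 hp.down (List.mem_of_mem_head? h1)
      · rcases le_or_gt d u with hd | hd
        · rw [pathGF_down (by omega), step u d h hd (by omega)]
          ring
        · rw [flagGF_eq_zero (by omega), flagGF_eq_zero (by omega), zero_add]
          refine pathGF_eq_zero fun p hp _ => ?_
          have := hp.staysAbove.count_le
          rw [hp.up, hp.down] at this
          omega
  · intro hm
    rcases u with _ | u
    · rw [flagGF_eq_zero (by omega)]
      refine pathGF_eq_zero fun p hp h1 => ?_
      rw [hp.staysAbove.eq_nil hp.up] at h1
      exact h1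
    · rw [pathGF_add endsHorizontal_iff (by rintro p ⟨h1, -⟩ h2; simp [h1] at h2),
        pathGF_up (Q := EndsHorizontal) (fun p => Iff.rfl),
        (ih (u + d + h + 1) (by omega) _ _ _).2 rfl]
      rcases le_or_gt d u with hd | hd
      · rw [pathGF_horizontal (by omega), step u d h hd (by omega)]
        ring
      · rw [flagGF_eq_zero (by omega), flagGF_eq_zero (by omega), zero_add]
        refine pathGF_eq_zero fun p hp h1 => ?_
        have h2 := hp.staysAbove
        rcases p with _ | ⟨s, p⟩
        · simp at h1
        · simp at h1
          subst h1
          have h3 := hp.up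
          have h4 := hp.down
          simp at h3 h4
          simpa [StaysAbove, h3, h4, hd.not_ge] using h2.2

/-- On paths with equally many upsteps and downsteps, the class ending horizontally has the hook
expression of the non-partition `(m, m + 1, …)`, which is `0`. -/
theorem pathGF_true (m h : ℕ) : pathGF (fun _ => True) m m h = flagGF m m h := by
  rw [pathGF_add (Q := fun p => ¬ EndsHorizontal p) (R := EndsHorizontal)
    (fun p => by simp [em']) (fun p h => h), ((pathGF_eq_flagGF _ _ _ _).1 rfl)]
  rcases h with _ | h
  · rw [pathGF_endsHorizontal_zero, add_zero]
  · rw [(pathGF_eq_flagGF _ _ _ _).2 rfl, flagGF_eq_zero m.lt_succ_self, add_zero]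

/-! ### Enumerating finite sets of natural numbers -/

theorem card_toFinset_mem (R : Finset ℕ) (hf : {x | x ∈ R}.Finite) :
    hf.toFinset.card = R.card := by
  congr 1
  ext x
  simp

theorem nth_mem_finset {R : Finset ℕ} {j : ℕ} (hj : j < R.card) : Nat.nth (· ∈ R) j ∈ R :=
  Nat.nth_mem (p := (· ∈ R)) j fun hf => by rwa [card_toFinset_mem]

theorem nth_lt_nth_finset {R : Finset ℕ} {i j : ℕ} (hij : i < j) (hj : j < R.card) :
    Nat.nth (· ∈ R) i < Nat.nth (· ∈ R) j :=
  Nat.nth_lt_nth' hij fun hf => by rwa [card_toFinset_mem]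

/-- The default value `0` of `Nat.nth` past the end agrees with the value that a tableau takes
outside its diagram. -/
theorem nth_finset_eq_zero {R : Finset ℕ} {j : ℕ} (hj : R.card ≤ j) : Nat.nth (· ∈ R) j = 0 :=
  Nat.nth_of_card_le (p := (· ∈ R)) R.finite_toSet (by rwa [card_toFinset_mem])

theorem count_nth_finset {R : Finset ℕ} {j : ℕ} (hj : j < R.card) :
    Nat.count (· ∈ R) (Nat.nth (· ∈ R) j) = j :=
  Nat.count_nth fun hf => by rwa [card_toFinset_mem]

theorem exists_nth_finset {R : Finset ℕ} {x : ℕ} (hx : x ∈ R) :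
    ∃ j < R.card, Nat.nth (· ∈ R) j = x := by
  obtain ⟨j, hj, h⟩ := Nat.exists_lt_card_finite_nth_eq (p := (· ∈ R)) R.finite_toSet hx
  exact ⟨j, by rwa [card_toFinset_mem] at hj, h⟩

theorem image_nth_finset (R : Finset ℕ) : (Finset.range R.card).image (Nat.nth (· ∈ R)) = R := by
  ext x
  simp only [Finset.mem_image, Finset.mem_range]
  exact ⟨by rintro ⟨j, hj, rfl⟩; exact nth_mem_finset hj, exists_nth_finset⟩

theorem nth_finset_inj {R : Finset ℕ} {i j : ℕ} (hi : i < R.card) (hj : j < R.card)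
    (h : Nat.nth (· ∈ R) i = Nat.nth (· ∈ R) j) : i = j := by
  rw [← count_nth_finset hi, h, count_nth_finset hj]

theorem count_image_of_strictMono {f : ℕ → ℕ} {m : ℕ} (hf : ∀ i j, i < j → j < m → f i < f j)
    {j : ℕ} (hj : j < m) : Nat.count (· ∈ (Finset.range m).image f) (f j) = j := by
  have hinj : ∀ i < m, ∀ i' < m, f i = f i' → i = i' := by
    intro i hi i' hi' h
    rcases lt_trichotomy i i' with h1 | h1 | h1
    · exact absurd h (hf _ _ h1 hi').ne
    · exact h1
    · exact absurd h.symm (hf _ _ h1 hi).ne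
  rw [Nat.count_eq_card_filter_range]
  have : (Finset.range (f j)).filter (· ∈ (Finset.range m).image f) = (Finset.range j).image f := by
    ext x
    simp only [Finset.mem_filter, Finset.mem_range, Finset.mem_image]
    constructor
    · rintro ⟨h1, i, hi, rfl⟩
      refine ⟨i, ?_, rfl⟩
      by_contra h2
      rcases (not_lt.1 h2).lt_or_eq with h3 | rfl
      · exact absurd (hf _ _ h3 hi) h1.not_gt
      · exact h1.false
    · rintro ⟨i, hi, rfl⟩
      exact ⟨hf _ _ hi hj, i, hi.trans hj, rfl⟩
  rw [this, Finset.card_image_of_injOn, Finset.card_range]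
  intro i hi i' hi' h
  simp only [Finset.coe_range, Set.mem_Iio] at hi hi'
  exact hinj i (hi.trans hj) i' (hi'.trans hj) h

theorem nth_image_of_strictMono {f : ℕ → ℕ} {m : ℕ} (hf : ∀ i j, i < j → j < m → f i < f j)
    {j : ℕ} (hj : j < m) : Nat.nth (· ∈ (Finset.range m).image f) j = f j := by
  have h := Nat.nth_count (p := (· ∈ (Finset.range m).image f)) (n := f j)
    (Finset.mem_image_of_mem _ (Finset.mem_range.2 hj))
  rwa [count_image_of_strictMono hf hj] at h

theorem card_image_of_strictMono {f : ℕ → ℕ} {m : ℕ} (hf : ∀ i j, i < j → j < m → f i < f j) :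
    ((Finset.range m).image f).card = m := by
  rw [Finset.card_image_of_injOn, Finset.card_range]
  intro i hi j hj h
  simp only [Finset.coe_range, Set.mem_Iio] at hi hj
  rw [← count_image_of_strictMono hf hi, h, count_image_of_strictMono hf hj]

theorem count_lt_count_of_mem {R : Finset ℕ} {x y : ℕ} (hx : x ∈ R) (h : x < y) :
    Nat.count (· ∈ R) x < Nat.count (· ∈ R) y :=
  Nat.count_strict_mono hx h

/-! ### Rows of tableaux -/

theorem rowEntries_eq {μ : YoungDiagram} (T : SemistandardYoungTableau μ) (r : ℕ) :
    rowEntries T r = (Finset.range (μ.rowLen r)).image (T r) := by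
  ext x
  simp [rowEntries, YoungDiagram.row_eq_prod]

theorem mem_rowEntries {μ : YoungDiagram} {T : SemistandardYoungTableau μ} {r x : ℕ} :
    x ∈ rowEntries T r ↔ ∃ j, (r, j) ∈ μ ∧ T r j = x := by
  simp [rowEntries_eq, YoungDiagram.mem_iff_lt_rowLen]

theorem maxValue_eq_sup {μ : YoungDiagram} (T : SemistandardYoungTableau μ) :
    maxValue T = (tabEntries T).sup id := by
  rw [tabEntries, Finset.sup_image]
  rfl

theorem sup_Icc_one (m : ℕ) : (Finset.Icc 1 m).sup id = m := by
  apply le_antisymm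
  · exact Finset.sup_le fun x hx => (Finset.mem_Icc.1 hx).2
  · rcases Nat.eq_zero_or_pos m with rfl | h
    · exact Nat.zero_le _
    · exact Finset.le_sup (f := id) (Finset.mem_Icc.2 ⟨h, le_rfl⟩)

theorem IsIncreasing.tabEntries_eq {μ : YoungDiagram} {T : SemistandardYoungTableau μ}
    (hT : IsIncreasing T) : tabEntries T = Finset.Icc 1 (maxValue T) := by
  obtain ⟨-, m, hm⟩ := hT
  rw [maxValue_eq_sup, hm, sup_Icc_one]

/-! ### Increasing tableaux with two rows -/

theorem mem_twoRow {n i j : ℕ} : (i, j) ∈ twoRow n ↔ i < 2 ∧ j < n := by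
  rw [twoRow, YoungDiagram.mem_ofRowLens]
  constructor
  · rintro ⟨h1, h2⟩
    simp only [List.length_cons, List.length_nil] at h1
    refine ⟨h1, ?_⟩
    interval_cases i <;> simpa using h2
  · rintro ⟨h1, h2⟩
    refine ⟨h1, ?_⟩
    interval_cases i <;> simpa using h2

theorem cells_twoRow (n : ℕ) : (twoRow n).cells = Finset.range 2 ×ˢ Finset.range n := by
  ext ⟨i, j⟩
  rw [YoungDiagram.mem_cells, mem_twoRow, Finset.mem_product, Finset.mem_range, Finset.mem_range]

theorem card_twoRow (n : ℕ) : (twoRow n).card = 2 * n := by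
  rw [YoungDiagram.card, cells_twoRow, Finset.card_product, Finset.card_range, Finset.card_range]

theorem rowEntries_twoRow {n r : ℕ} (hr : r < 2) (T : SemistandardYoungTableau (twoRow n)) :
    rowEntries T r = (Finset.range n).image (T r) := by
  ext x
  simp [mem_rowEntries, mem_twoRow, hr]

theorem tabEntries_twoRow {n : ℕ} (T : SemistandardYoungTableau (twoRow n)) :
    tabEntries T = rowEntries T 0 ∪ rowEntries T 1 := by
  ext x
  rw [Finset.mem_union, mem_rowEntries, mem_rowEntries, tabEntries, Finset.mem_image]
  constructor
  · rintro ⟨⟨i, j⟩, h, rfl⟩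
    have h1 := (mem_twoRow.1 h).1
    interval_cases i
    · exact Or.inl ⟨j, h, rfl⟩
    · exact Or.inr ⟨j, h, rfl⟩
  · rintro (⟨j, h, rfl⟩ | ⟨j, h, rfl⟩)
    · exact ⟨(0, j), h, rfl⟩
    · exact ⟨(1, j), h, rfl⟩

/-- The pairs of sets that are the rows of an increasing tableau of shape `2 × n` with maximum
value `m`. -/
structure IsRowPair (n m : ℕ) (R S : Finset ℕ) : Prop where
  card_left : R.card = n
  card_right : S.card = n
  union : R ∪ S = Finset.Icc 1 m
  count_lt : ∀ x ∈ S, Nat.count (· ∈ S) x < Nat.count (· ∈ R) x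

theorem IsIncreasing.strictMono {n r : ℕ} {T : SemistandardYoungTableau (twoRow n)}
    (hT : IsIncreasing T) (hr : r < 2) : ∀ i j, i < j → j < n → T r i < T r j :=
  fun i j h hj => hT.1 r i j h (mem_twoRow.2 ⟨hr, hj⟩)

theorem IsIncreasing.nth_rowEntries {n r : ℕ} {T : SemistandardYoungTableau (twoRow n)}
    (hT : IsIncreasing T) (hr : r < 2) {j : ℕ} (hj : j < n) :
    Nat.nth (· ∈ rowEntries T r) j = T r j := by
  rw [rowEntries_twoRow hr]
  exact nth_image_of_strictMono (hT.strictMono hr) hj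

theorem IsIncreasing.isRowPair {n : ℕ} {T : SemistandardYoungTableau (twoRow n)}
    (hT : IsIncreasing T) : IsRowPair n (maxValue T) (rowEntries T 0) (rowEntries T 1) where
  card_left := by
    rw [rowEntries_twoRow two_pos]
    exact card_image_of_strictMono (hT.strictMono two_pos)
  card_right := by
    rw [rowEntries_twoRow one_lt_two]
    exact card_image_of_strictMono (hT.strictMono one_lt_two)
  union := by rw [← tabEntries_twoRow, hT.tabEntries_eq]
  count_lt := by
    intro x hx
    rw [rowEntries_twoRow one_lt_two] at hx ⊢
    obtain ⟨j, hj, rfl⟩ := Finset.mem_image.1 hx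
    rw [Finset.mem_range] at hj
    rw [count_image_of_strictMono (hT.strictMono one_lt_two) hj, rowEntries_twoRow two_pos]
    nth_rw 1 [← count_image_of_strictMono (hT.strictMono two_pos) hj]
    exact count_lt_count_of_mem (Finset.mem_image_of_mem _ (Finset.mem_range.2 hj))
      (T.col_strict one_pos (mem_twoRow.2 ⟨one_lt_two, hj⟩))

theorem IsIncreasing.ext_rows {n : ℕ} {T T' : SemistandardYoungTableau (twoRow n)}
    (hT : IsIncreasing T) (hT' : IsIncreasing T') (h0 : rowEntries T 0 = rowEntries T' 0)
    (h1 : rowEntries T 1 = rowEntries T' 1) : T = T' := by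
  apply SemistandardYoungTableau.ext
  intro i j
  by_cases h : (i, j) ∈ twoRow n
  · obtain ⟨hi, hj⟩ := mem_twoRow.1 h
    rw [← hT.nth_rowEntries hi hj, ← hT'.nth_rowEntries hi hj]
    interval_cases i
    · rw [h0]
    · rw [h1]
  · rw [T.zeros h, T'.zeros h]

/-- The element of `S` with index `j` has `j` elements of `S` below it, hence more than `j` elements
of `R`. -/
theorem nth_lt_nth_of_count_lt {R S : Finset ℕ}
    (h : ∀ x ∈ S, Nat.count (· ∈ S) x < Nat.count (· ∈ R) x) {j : ℕ} (hj : j < S.card) :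
    Nat.nth (· ∈ R) j < Nat.nth (· ∈ S) j := by
  apply Nat.nth_lt_of_lt_count
  have := h _ (nth_mem_finset hj)
  rwa [count_nth_finset hj] at this

theorem IsRowPair.exists_tableau {n m : ℕ} {R S : Finset ℕ} (h : IsRowPair n m R S) :
    ∃ T : SemistandardYoungTableau (twoRow n), IsIncreasing T ∧ maxValue T = m ∧
      rowEntries T 0 = R ∧ rowEntries T 1 = S := by
  obtain ⟨rfl, hS, hU, hc⟩ := h
  let f : ℕ → ℕ → ℕ := fun i j =>
    if i = 0 then Nat.nth (· ∈ R) j else if i = 1 then Nat.nth (· ∈ S) j else 0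
  have hmono : ∀ i j₁ j₂, j₁ < j₂ → (i, j₂) ∈ twoRow R.card → f i j₁ < f i j₂ := by
    intro i j₁ j₂ h1 h2
    obtain ⟨hi, hj⟩ := mem_twoRow.1 h2
    interval_cases i
    · exact nth_lt_nth_finset h1 hj
    · exact nth_lt_nth_finset h1 (hS.symm ▸ hj)
  let T : SemistandardYoungTableau (twoRow R.card) :=
    { entry := f
      row_weak' := fun h1 h2 => (hmono _ _ _ h1 h2).le
      col_strict' := by
        intro i₁ i₂ j h1 h2
        obtain ⟨hi, hj⟩ := mem_twoRow.1 h2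
        obtain ⟨rfl, rfl⟩ : i₁ = 0 ∧ i₂ = 1 := by omega
        exact nth_lt_nth_of_count_lt hc (hS.symm ▸ hj)
      zeros' := by
        intro i j h1
        rw [mem_twoRow, not_and_or, not_lt, not_lt] at h1
        simp only [f]
        split_ifs with h2 h3
        · exact nth_finset_eq_zero (by omega)
        · exact nth_finset_eq_zero (by omega)
        · rfl }
  have hT0 : rowEntries T 0 = R := by
    rw [rowEntries_twoRow two_pos]
    exact image_nth_finset R
  have hT1 : rowEntries T 1 = S := by
    rw [rowEntries_twoRow one_lt_two]
    have h1 := image_nth_finset S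
    rwa [hS] at h1
  have hT : tabEntries T = Finset.Icc 1 m := by rw [tabEntries_twoRow, hT0, hT1, hU]
  exact ⟨T, ⟨hmono, m, hT⟩, by rw [maxValue_eq_sup, hT, sup_Icc_one], hT0, hT1⟩

/-! ### Small Schröder paths and increasing tableaux with two rows -/

theorem sum_vec (p : List PathStep) : (p.map PathStep.vec).sum =
    ((p.count up + p.count down + 2 * p.count horizontal : ℤ), (p.count up - p.count down : ℤ)) := by
  induction p with
  | nil => rfl
  | cons s p ih =>
    rw [List.map_cons, List.sum_cons, ih]
    cases s <;> simp [PathStep.vec] <;> ring_nf <;> simp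

theorem pathPoint_snd (p : List PathStep) (i : ℕ) :
    (pathPoint p i).2 = ((p.take i).count up - (p.take i).count down : ℤ) := by
  rw [pathPoint, sum_vec]

theorem pathPoint_length (p : List PathStep) : pathPoint p p.length =
    ((p.count up + p.count down + 2 * p.count horizontal : ℤ), (p.count up - p.count down : ℤ)) := by
  rw [pathPoint, List.take_length, sum_vec]

theorem length_eq_count (p : List PathStep) :
    p.length = p.count up + p.count down + p.count horizontal := by
  induction p with
  | nil => rfl
  | cons s p ih => cases s <;> simp <;> omega

theorem staysAbove_reverse_iff (p : List PathStep) : StaysAbove p.reverse ↔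
    ∀ i s, p[i]? = some s → s = up ∨ (p.take i).count down < (p.take i).count up := by
  induction p using List.reverseRecOn with
  | nil => simp [StaysAbove]
  | append_singleton p s ih =>
    rw [List.reverse_append, List.reverse_singleton, List.singleton_append, StaysAbove, ih,
      List.count_reverse, List.count_reverse]
    constructor
    · rintro ⟨h1, h2⟩ i s' h
      rcases lt_trichotomy i p.length with hi | rfl | hi
      · rw [List.getElem?_append_left hi] at h
        rw [List.take_append_of_le_length hi.le]
        exact h1 i s' h
      · simp at h
        subst h
        simpa using h2
      · rw [List.getElem?_eq_none (by simp; omega)] at h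
        simp at h
    · intro H
      constructor
      · intro i s' h
        have hi : i < p.length := (List.getElem?_eq_some_iff.1 h).1
        have := H i s' (by rwa [List.getElem?_append_left hi])
        rwa [List.take_append_of_le_length hi.le] at this
      · simpa using H p.length s (by simp)

/-- A downstep must start above the axis because it must not end below it, a horizontal step because
it must not lie on the axis. Both conditions become the single one in `StaysAbove`. -/
theorem isSmallSchroder_iff {n : ℕ} {p : List PathStep} : IsSmallSchroder n p ↔
    StaysAbove p.reverse ∧ p.count up = p.count down ∧ p.count up + p.count horizontal = n := by
  have hend : pathPoint p p.length = (2 * (n : ℤ), 0) ↔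
      p.count up = p.count down ∧ p.count up + p.count horizontal = n := by
    rw [pathPoint_length, Prod.mk.injEq]
    omega
  constructor
  · rintro ⟨h1, h2, h3⟩
    refine ⟨?_, hend.1 h1⟩
    rw [staysAbove_reverse_iff]
    intro i s hs
    obtain ⟨hi, hs'⟩ := List.getElem?_eq_some_iff.1 hs
    cases s
    · exact Or.inl rfl
    · right
      have := h2 (i + 1) hi
      rw [pathPoint_snd, List.take_succ_eq_append_getElem hi, hs'] at this
      simp at this
      omega
    · right
      have h4 := h3 i hi hs
      have h5 := h2 i hi.le
      rw [pathPoint_snd] at h4 h5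
      omega
  · rintro ⟨h1, h2⟩
    have h3 : ∀ i, (p.take i).count down ≤ (p.take i).count up := by
      intro i
      have h4 : StaysAbove (p.take i).reverse := by
        rw [staysAbove_reverse_iff] at h1 ⊢
        intro j s hs
        have hj := (List.getElem?_eq_some_iff.1 hs).1
        rw [List.length_take] at hj
        rw [List.getElem?_take_of_lt (by omega)] at hs
        rw [List.take_take, min_eq_left (by omega)]
        exact h1 j s hs
      simpa using h4.count_le
    refine ⟨hend.2 h2, ?_, ?_⟩
    · intro i _
      have := h3 i
      rw [pathPoint_snd]
      omega
    · intro i _ hs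
      have := (staysAbove_reverse_iff p).1 h1 i _ hs
      simp at this
      rw [pathPoint_snd]
      omega

/-- The segment for the number `j`, given the two rows of a tableau. -/
def rowSegment (R S : Finset ℕ) (j : ℕ) : PathStep :=
  if j ∈ R then if j ∈ S then horizontal else up else down

/-- The path of a tableau with the given two rows. -/
def rowPath (R S : Finset ℕ) (m : ℕ) : List PathStep :=
  (List.range' 1 m).map (rowSegment R S)

theorem segments_eq_rowPath {μ : YoungDiagram} (T : SemistandardYoungTableau μ) :
    segments T = rowPath (rowEntries T 0) (rowEntries T 1) (maxValue T) := rfl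

@[simp] theorem length_rowPath (R S : Finset ℕ) (m : ℕ) : (rowPath R S m).length = m := by
  simp [rowPath]

theorem getElem?_rowPath {R S : Finset ℕ} {m i : ℕ} (hi : i < m) :
    (rowPath R S m)[i]? = some (rowSegment R S (i + 1)) := by
  simp [rowPath, hi, add_comm]

theorem rowPath_succ (R S : Finset ℕ) (m : ℕ) :
    rowPath R S (m + 1) = rowPath R S m ++ [rowSegment R S (m + 1)] := by
  simp [rowPath, List.range'_1_concat, add_comm]

theorem take_rowPath {R S : Finset ℕ} {m i : ℕ} (hi : i ≤ m) :
    (rowPath R S m).take i = rowPath R S i := by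
  apply List.ext_getElem <;> simp [rowPath, hi]

/-- `Nat.count` counts strictly below its argument, hence the `i + 1`; the number `0` lies in
neither set. -/
theorem count_rowPath {R S : Finset ℕ} {m : ℕ} (hU : R ∪ S = Finset.Icc 1 m) {i : ℕ} (hi : i ≤ m) :
    (rowPath R S i).count up + (rowPath R S i).count horizontal = Nat.count (· ∈ R) (i + 1) ∧
      (rowPath R S i).count down + (rowPath R S i).count horizontal =
        Nat.count (· ∈ S) (i + 1) := by
  induction i with
  | zero =>
    have h0 : 0 ∉ R ∪ S := by simp [hU]
    rw [Finset.mem_union, not_or] at h0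
    simp [rowPath, Nat.count_succ, h0]
  | succ i ih =>
    obtain ⟨h1, h2⟩ := ih (by omega)
    have h3 : i + 1 ∈ R ∪ S := by rw [hU, Finset.mem_Icc]; omega
    rw [Finset.mem_union] at h3
    rw [Nat.count_succ _ (i + 1), Nat.count_succ _ (i + 1), ← h1, ← h2, rowPath_succ]
    by_cases h4 : i + 1 ∈ R <;> by_cases h5 : i + 1 ∈ S
    · simp [rowSegment, h4, h5]; omega
    · simp [rowSegment, h4, h5]; omega
    · simp [rowSegment, h4, h5]; omega
    · tauto

theorem count_finset_eq_card {R : Finset ℕ} {m : ℕ} (h : ∀ x ∈ R, x < m) :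
    Nat.count (· ∈ R) m = R.card := by
  rw [Nat.count_eq_card_filter_range]
  congr 1
  ext x
  simp only [Finset.mem_filter, Finset.mem_range]
  exact ⟨fun h => h.2, fun hx => ⟨h x hx, hx⟩⟩

/-- The horizontal steps before position `x` count once for `R` and once for `S`. They cancel, so
the comparison at `x ∈ S` says that more upsteps than downsteps precede step `x`. -/
theorem isRowPair_iff {n m : ℕ} {R S : Finset ℕ} (hU : R ∪ S = Finset.Icc 1 m) :
    IsRowPair n m R S ↔ IsSmallSchroder n (rowPath R S m) := by
  have hm : ∀ x ∈ R ∪ S, x < m + 1 := fun x hx => by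
    rw [hU, Finset.mem_Icc] at hx
    omega
  have hR := count_finset_eq_card fun x hx => hm x (Finset.mem_union_left S hx)
  have hS := count_finset_eq_card fun x hx => hm x (Finset.mem_union_right R hx)
  obtain ⟨h1, h2⟩ := count_rowPath hU le_rfl
  rw [hR] at h1
  rw [hS] at h2
  have key : (∀ x ∈ S, Nat.count (· ∈ S) x < Nat.count (· ∈ R) x) ↔
      StaysAbove (rowPath R S m).reverse := by
    rw [staysAbove_reverse_iff]
    constructor
    · intro h i s hs
      have hi := (List.getElem?_eq_some_iff.1 hs).1
      rw [length_rowPath] at hi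
      rw [getElem?_rowPath hi, Option.some.injEq] at hs
      obtain ⟨h3, h4⟩ := count_rowPath hU hi.le
      rw [take_rowPath hi.le]
      by_cases h5 : i + 1 ∈ S
      · have := h _ h5
        omega
      · left
        have h6 : i + 1 ∈ R ∪ S := by rw [hU, Finset.mem_Icc]; omega
        have h7 := (Finset.mem_union.1 h6).resolve_right h5
        simp [← hs, rowSegment, h5, h7]
    · intro h x hx
      have h3 : x ∈ R ∪ S := Finset.mem_union_right R hx
      rw [hU, Finset.mem_Icc] at h3
      obtain ⟨i, rfl⟩ : ∃ i, x = i + 1 := ⟨x - 1, by omega⟩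
      have h4 := h i _ (getElem?_rowPath (by omega))
      rw [take_rowPath (by omega)] at h4
      obtain ⟨h5, h6⟩ := count_rowPath hU (show i ≤ m by omega)
      rcases h4 with h4 | h4
      · simp only [rowSegment, hx, if_true] at h4
        split_ifs at h4
      · omega
  rw [isSmallSchroder_iff, ← key]
  constructor
  · rintro ⟨h3, h4, -, h5⟩
    exact ⟨h5, by omega, by omega⟩
  · rintro ⟨h3, h4, h5⟩
    exact ⟨by omega, by omega, hU, h3⟩

theorem exists_rowPath (p : List PathStep) :
    ∃ R S, R ∪ S = Finset.Icc 1 p.length ∧ rowPath R S p.length = p := by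
  induction p using List.reverseRecOn with
  | nil => exact ⟨∅, ∅, rfl, rfl⟩
  | append_singleton p s ih =>
    obtain ⟨R, S, h1, h2⟩ := ih
    have hx : ∀ x ∈ R ∪ S, x < p.length + 1 := fun x hx => by
      rw [h1, Finset.mem_Icc] at hx
      omega
    have hR : p.length + 1 ∉ R := fun h => (hx _ (Finset.mem_union_left _ h)).false
    have hS : p.length + 1 ∉ S := fun h => (hx _ (Finset.mem_union_right _ h)).false
    have hI : Finset.Icc 1 (p.length + 1) = insert (p.length + 1) (Finset.Icc 1 p.length) :=
      (Finset.insert_Icc_right_eq_Icc_add_one (by omega)).symm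
    refine ⟨if s = down then R else insert (p.length + 1) R,
      if s = up then S else insert (p.length + 1) S, ?_, ?_⟩
    · rw [List.length_append, List.length_singleton, hI, ← h1]
      cases s <;> simp
    · rw [List.length_append, List.length_singleton, rowPath_succ]
      congr 1
      · refine Eq.trans ?_ h2
        apply List.map_congr_left
        intro j hj
        rw [List.mem_range'_1] at hj
        have hj' : j ≠ p.length + 1 := by omega
        cases s <;> simp [rowSegment, hj']
      · cases s <;> simp [rowSegment, hR, hS]

/-- `rowSegment` reads a number in neither set as a downstep; the assumptions on the unions remove
this ambiguity. -/
theorem rowPath_injective {m m' : ℕ} {R S R' S' : Finset ℕ} (hU : R ∪ S = Finset.Icc 1 m)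
    (hU' : R' ∪ S' = Finset.Icc 1 m') (h : rowPath R S m = rowPath R' S' m') :
    R = R' ∧ S = S' := by
  have hm : m = m' := by simpa using congrArg List.length h
  subst hm
  have hs : ∀ j ∈ Finset.Icc 1 m, rowSegment R S j = rowSegment R' S' j := by
    intro j hj
    rw [Finset.mem_Icc] at hj
    obtain ⟨i, rfl⟩ : ∃ i, j = i + 1 := ⟨j - 1, by omega⟩
    have h1 := congrArg (·[i]?) h
    simpa [getElem?_rowPath (show i < m by omega)] using h1
  have key : ∀ x, (x ∈ R ↔ x ∈ R') ∧ (x ∈ S ↔ x ∈ S') := by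
    intro x
    by_cases hx : x ∈ Finset.Icc 1 m
    · have h1 := hs x hx
      have h2 := hx
      rw [← hU, Finset.mem_union] at h2
      rw [← hU', Finset.mem_union] at hx
      by_cases a : x ∈ R <;> by_cases b : x ∈ S <;> by_cases c : x ∈ R' <;> by_cases d : x ∈ S' <;>
        simp [rowSegment, a, b, c, d] at h1 h2 hx ⊢
    · have h1 := hx
      rw [← hU, Finset.mem_union] at h1
      rw [← hU', Finset.mem_union] at hx
      tauto
  exact ⟨Finset.ext fun x => (key x).1, Finset.ext fun x => (key x).2⟩

theorem IsIncreasing.isSmallSchroder {n : ℕ} {T : SemistandardYoungTableau (twoRow n)}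
    (hT : IsIncreasing T) : IsSmallSchroder n (segments T) :=
  (isRowPair_iff hT.isRowPair.union).1 hT.isRowPair

theorem IsIncreasing.segments_injective {n : ℕ} {T T' : SemistandardYoungTableau (twoRow n)}
    (hT : IsIncreasing T) (hT' : IsIncreasing T') (h : segments T = segments T') : T = T' := by
  obtain ⟨h0, h1⟩ := rowPath_injective hT.isRowPair.union hT'.isRowPair.union h
  exact hT.ext_rows hT' h0 h1

theorem IsSmallSchroder.exists_tableau {n : ℕ} {p : List PathStep} (hp : IsSmallSchroder n p) :
    ∃ T : SemistandardYoungTableau (twoRow n), IsIncreasing T ∧ segments T = p := by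
  obtain ⟨R, S, hU, hp'⟩ := exists_rowPath p
  rw [← hp'] at hp
  obtain ⟨T, hT, hm, h0, h1⟩ := ((isRowPair_iff hU).2 hp).exists_tableau
  exact ⟨T, hT, by rw [segments_eq_rowPath, h0, h1, hm, hp']⟩

theorem IsIncreasing.maxValue_add_count {n : ℕ} {T : SemistandardYoungTableau (twoRow n)}
    (hT : IsIncreasing T) : maxValue T + (segments T).count horizontal = (twoRow n).card := by
  obtain ⟨-, h1, h2⟩ := isSmallSchroder_iff.1 hT.isSmallSchroder
  have h3 := length_eq_count (segments T)
  rw [segments_eq_rowPath, length_rowPath, ← segments_eq_rowPath] at h3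
  rw [card_twoRow]
  omega

/-- The bijection from increasing tableaux with two rows to small Schröder paths. -/
noncomputable def schroderEquiv (n : ℕ) : IncTableau (twoRow n) ≃ SchroderPath n :=
  Equiv.ofBijective (fun T => ⟨segments T.1, T.2.isSmallSchroder⟩)
    ⟨fun T T' h => Subtype.ext (T.2.segments_injective T'.2 (congrArg Subtype.val h)), fun p => by
      obtain ⟨T, hT, h⟩ := p.2.exists_tableau
      exact ⟨⟨T, hT⟩, Subtype.ext h⟩⟩

/-- The restriction of the bijection to paths with a given number of horizontal steps. -/
noncomputable def schroderEquivWith (n k : ℕ) : Inc (twoRow n) k ≃ SchroderPathWith n k :=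
  Equiv.ofBijective (fun T => ⟨segments T.1, T.2.1.isSmallSchroder, by
      have h1 := T.2.1.maxValue_add_count
      have h2 := T.2.2
      omega⟩)
    ⟨fun T T' h => Subtype.ext (T.2.1.segments_injective T'.2.1 (congrArg Subtype.val h)),
      fun p => by
        obtain ⟨T, hT, h⟩ := p.2.1.exists_tableau
        refine ⟨⟨T, hT, ?_⟩, Subtype.ext h⟩
        rw [← hT.maxValue_add_count, h, p.2.2]⟩

theorem finite_incTableau_twoRow (n : ℕ) : Finite (IncTableau (twoRow n)) := by
  -- The number of horizontal steps is `2n` minus the maximum value, so only finitely many values of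
  -- `k` occur.
  let F : IncTableau (twoRow n) → Σ k : Fin (2 * n + 1), Inc (twoRow n) k := fun T =>
    ⟨⟨(segments T.1).count horizontal, by
      have := T.2.maxValue_add_count
      rw [card_twoRow] at this
      omega⟩, T.1, T.2, T.2.maxValue_add_count⟩
  refine Finite.of_injective F fun T T' h => Subtype.ext ?_
  exact congrArg (fun x : Σ k : Fin (2 * n + 1), Inc (twoRow n) k => x.2.1) h

theorem isEmpty_schroderPathWith {n k : ℕ} (hn : 1 ≤ n) (hk : n ≤ k) :
    IsEmpty (SchroderPathWith n k) := by
  refine ⟨fun ⟨p, hp, hc⟩ => ?_⟩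
  obtain ⟨h1, h2, h3⟩ := isSmallSchroder_iff.1 hp
  have h4 := h1.eq_nil (by rw [List.count_reverse]; omega)
  rw [List.reverse_eq_nil_iff] at h4
  subst h4
  simp at hc
  omega

/-! ### The major index -/

theorem pathMaj_rowPath (R S : Finset ℕ) {m : ℕ} (hU : R ∪ S = Finset.Icc 1 m) {j : ℕ}
    (hj : j ≤ m) : pathMaj (rowPath R S j).reverse =
      ∑ i ∈ Finset.range j, if i ∈ R ∧ i + 1 ∈ S then i else 0 := by
  induction j with
  | zero => rfl
  | succ j ih =>
    rw [Finset.sum_range_succ, ← ih (by omega), rowPath_succ, List.reverse_append,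
      List.reverse_singleton, List.singleton_append, pathMaj, List.length_reverse, length_rowPath]
    congr 1
    have h1 : rowSegment R S (j + 1) ≠ up ↔ j + 1 ∈ S := by
      have h : j + 1 ∈ R ∪ S := by rw [hU, Finset.mem_Icc]; omega
      rw [Finset.mem_union] at h
      by_cases a : j + 1 ∈ R <;> by_cases b : j + 1 ∈ S <;> simp [rowSegment, a, b] at h ⊢
    -- The first step has no predecessor, but its possible contribution is `0` on both sides.
    rcases j with _ | j
    · simp
    · have h2 : (rowPath R S (j + 1)).reverse.head? ≠ some down ↔ j + 1 ∈ R := by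
        rw [rowPath_succ, List.reverse_append, List.reverse_singleton, List.singleton_append]
        by_cases a : j + 1 ∈ R <;> by_cases b : j + 1 ∈ S <;> simp [rowSegment, a, b]
      simp only [h1, h2, and_comm]

theorem IsIncreasing.pathMaj_segments {n : ℕ} {T : SemistandardYoungTableau (twoRow n)}
    (hT : IsIncreasing T) : pathMaj (segments T).reverse = maj T := by
  rw [segments_eq_rowPath, pathMaj_rowPath _ _ hT.isRowPair.union le_rfl, maj,
    ← Finset.sum_filter]
  refine Finset.sum_congr ?_ fun _ _ => rfl
  ext i
  simp only [Finset.mem_filter, Finset.mem_range]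
  constructor
  · exact fun h => h.2
  · intro h
    have : i + 1 ∈ rowEntries T 0 ∪ rowEntries T 1 := Finset.mem_union_right _ h.2
    rw [hT.isRowPair.union, Finset.mem_Icc] at this
    exact ⟨by omega, h⟩

theorem isPartialPath_reverse_iff {n k : ℕ} (h : k < n) {p : List PathStep} :
    IsPartialPath (n - k) (n - k) k p.reverse ↔
      IsSmallSchroder n p ∧ p.count horizontal = k := by
  rw [isSmallSchroder_iff]
  constructor
  · rintro ⟨h1, h2, h3, h4⟩
    rw [List.count_reverse] at h2 h3 h4
    exact ⟨⟨h1, by omega, by omega⟩, h4⟩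
  · rintro ⟨⟨h1, h2, h3⟩, h4⟩
    exact ⟨h1, by rw [List.count_reverse]; omega, by rw [List.count_reverse]; omega,
      by rw [List.count_reverse]; omega⟩

theorem sum_maj_eq {n k : ℕ} (h : k < n) :
    ∑ T : Inc (twoRow n) k, (RatFunc.X : RatFunc ℚ) ^ maj T.1 = flagGF (n - k) (n - k) k := by
  classical
  have h0 : pathGF (fun _ => True) (n - k) (n - k) k =
      ∑ p ∈ (stepWords (n - k + (n - k) + k)).filter (IsPartialPath (n - k) (n - k) k),
        RatFunc.X ^ pathMaj p := by
    rw [pathGF, Finset.sum_filter]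
    exact Finset.sum_congr rfl fun p _ => by simp
  rw [← pathGF_true, h0]
  refine Finset.sum_bij (fun T _ => (segments T.1).reverse) ?_ ?_ ?_ ?_
  · intro T _
    have h1 := (isPartialPath_reverse_iff h).2 (schroderEquivWith n k T).2
    exact Finset.mem_filter.2 ⟨mem_stepWords.2 h1.length, h1⟩
  · intro T _ T' _ h1
    exact Subtype.ext (T.2.1.segments_injective T'.2.1 (List.reverse_injective h1))
  · intro p hp
    have h1 := (Finset.mem_filter.1 hp).2
    rw [← List.reverse_reverse p] at h1
    obtain ⟨T, hT⟩ := (schroderEquivWith n k).surjective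
      ⟨p.reverse, (isPartialPath_reverse_iff h).1 h1⟩
    refine ⟨T, Finset.mem_univ _, ?_⟩
    rw [← List.reverse_reverse p]
    exact congrArg List.reverse (congrArg Subtype.val hT)
  · intro T _
    rw [T.2.1.pathMaj_segments]

/-! ### Successors in a finite set of natural numbers -/

/-- The elements of `S` that follow immediately, in `S`, on an element of `X`. -/
noncomputable def rightOf (X S : Finset ℕ) : Finset ℕ :=
  ((Finset.range (S.card - 1)).filter fun j => Nat.nth (· ∈ S) j ∈ X).image
    fun j => Nat.nth (· ∈ S) (j + 1)

/-- The elements of `S` that are followed immediately, in `S`, by an element of `X`. -/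
noncomputable def leftOf (X S : Finset ℕ) : Finset ℕ :=
  ((Finset.range (S.card - 1)).filter fun j => Nat.nth (· ∈ S) (j + 1) ∈ X).image
    fun j => Nat.nth (· ∈ S) j

theorem mem_rightOf {X S : Finset ℕ} {x : ℕ} : x ∈ rightOf X S ↔
    ∃ j, j + 1 < S.card ∧ Nat.nth (· ∈ S) j ∈ X ∧ Nat.nth (· ∈ S) (j + 1) = x := by
  simp [rightOf, Nat.lt_sub_iff_add_lt, and_assoc]

theorem mem_leftOf {X S : Finset ℕ} {x : ℕ} : x ∈ leftOf X S ↔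
    ∃ j, j + 1 < S.card ∧ Nat.nth (· ∈ S) (j + 1) ∈ X ∧ Nat.nth (· ∈ S) j = x := by
  simp [leftOf, Nat.lt_sub_iff_add_lt, and_assoc]

theorem rightOf_subset (X S : Finset ℕ) : rightOf X S ⊆ S := by
  intro x hx
  obtain ⟨j, h1, -, rfl⟩ := mem_rightOf.1 hx
  exact nth_mem_finset h1

theorem leftOf_subset (X S : Finset ℕ) : leftOf X S ⊆ S := by
  intro x hx
  obtain ⟨j, h1, -, rfl⟩ := mem_leftOf.1 hx
  exact nth_mem_finset (by omega)

theorem nth_succ_mem_rightOf {X S : Finset ℕ} {j : ℕ} (hj : j + 1 < S.card) :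
    Nat.nth (· ∈ S) (j + 1) ∈ rightOf X S ↔ Nat.nth (· ∈ S) j ∈ X := by
  rw [mem_rightOf]
  constructor
  · rintro ⟨i, h1, h2, h3⟩
    obtain rfl : i = j := Nat.succ_injective (nth_finset_inj h1 hj h3)
    exact h2
  · exact fun h => ⟨j, hj, h, rfl⟩

theorem nth_mem_leftOf {X S : Finset ℕ} {j : ℕ} (hj : j + 1 < S.card) :
    Nat.nth (· ∈ S) j ∈ leftOf X S ↔ Nat.nth (· ∈ S) (j + 1) ∈ X := by
  rw [mem_leftOf]
  constructor
  · rintro ⟨i, h1, h2, h3⟩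
    obtain rfl : i = j := nth_finset_inj (by omega) (by omega) h3
    exact h2
  · exact fun h => ⟨j, hj, h, rfl⟩

theorem nth_zero_notMem_rightOf (X S : Finset ℕ) : Nat.nth (· ∈ S) 0 ∉ rightOf X S := by
  rw [mem_rightOf]
  rintro ⟨i, h1, -, h3⟩
  exact Nat.succ_ne_zero i (nth_finset_inj h1 (by omega) h3)

theorem rightOf_leftOf {X S : Finset ℕ} (hX : X ⊆ S) (h0 : Nat.nth (· ∈ S) 0 ∉ X) :
    rightOf (leftOf X S) S = X := by
  ext x
  constructor
  · intro hx
    obtain ⟨j, hj, h1, rfl⟩ := mem_rightOf.1 hx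
    exact (nth_mem_leftOf hj).1 h1
  · intro hx
    obtain ⟨j, hj, rfl⟩ := exists_nth_finset (hX hx)
    rcases j with _ | j
    · exact absurd hx h0
    · exact (nth_succ_mem_rightOf hj).2 ((nth_mem_leftOf hj).2 hx)

/-- Only the last element of `S` lacks a right neighbour, so it is the only one that can be lost. -/
theorem leftOf_rightOf {X S : Finset ℕ} (hX : X ⊆ S)
    (h0 : ∀ j, j + 1 = S.card → Nat.nth (· ∈ S) j ∉ X) : leftOf (rightOf X S) S = X := by
  ext x
  constructor
  · intro hx
    obtain ⟨j, hj, h1, rfl⟩ := mem_leftOf.1 hx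
    exact (nth_succ_mem_rightOf hj).1 h1
  · intro hx
    obtain ⟨j, hj, rfl⟩ := exists_nth_finset (hX hx)
    rcases (Nat.succ_le_of_lt hj).lt_or_eq with h | h
    · exact (nth_mem_leftOf h).2 ((nth_succ_mem_rightOf h).2 hx)
    · exact absurd hx (h0 j h)

theorem card_rightOf_le (X S : Finset ℕ) : (rightOf X S).card ≤ X.card := by
  refine Finset.card_image_le.trans
    (Finset.card_le_card_of_injOn (Nat.nth (· ∈ S)) (fun j hj => (Finset.mem_filter.1 hj).2) ?_)
  intro i hi j hj h
  have h1 := Finset.mem_range.1 (Finset.mem_filter.1 hi).1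
  have h2 := Finset.mem_range.1 (Finset.mem_filter.1 hj).1
  exact nth_finset_inj (by omega) (by omega) h

theorem card_leftOf_le (X S : Finset ℕ) : (leftOf X S).card ≤ X.card := by
  refine Finset.card_image_le.trans
    (Finset.card_le_card_of_injOn (fun j => Nat.nth (· ∈ S) (j + 1))
      (fun j hj => (Finset.mem_filter.1 hj).2) ?_)
  intro i hi j hj h
  have h1 := Finset.mem_range.1 (Finset.mem_filter.1 hi).1
  have h2 := Finset.mem_range.1 (Finset.mem_filter.1 hj).1
  exact Nat.succ_injective (nth_finset_inj (by omega) (by omega) h)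

/-! ### Counting elements below a bound -/

theorem count_sdiff_add {X Y : Finset ℕ} (h : Y ⊆ X) (x : ℕ) :
    Nat.count (· ∈ X \ Y) x + Nat.count (· ∈ Y) x = Nat.count (· ∈ X) x := by
  induction x with
  | zero => simp
  | succ x ih =>
    rw [Nat.count_succ, Nat.count_succ, Nat.count_succ, ← ih]
    by_cases h1 : x ∈ Y
    · simp [h1, h h1]; omega
    · by_cases h2 : x ∈ X <;> simp [h1, h2]; omega

/-- The count of `Y` grows only when an element of `Y` is passed, and there it was strictly smaller
before. -/
theorem count_le_count {X Y : Finset ℕ}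
    (h : ∀ x ∈ Y, Nat.count (· ∈ Y) x < Nat.count (· ∈ X) x) (x : ℕ) :
    Nat.count (· ∈ Y) x ≤ Nat.count (· ∈ X) x := by
  induction x with
  | zero => simp
  | succ x ih =>
    rw [Nat.count_succ, Nat.count_succ]
    by_cases h1 : x ∈ Y
    · have := h x h1
      simp only [h1, if_true]
      omega
    · simp only [h1, if_false]
      omega

theorem count_nth_succ {X S : Finset ℕ} (hX : X ⊆ S) {j : ℕ} (hj : j + 1 < S.card) :
    Nat.count (· ∈ X) (Nat.nth (· ∈ S) (j + 1)) =
      Nat.count (· ∈ X) (Nat.nth (· ∈ S) j) + if Nat.nth (· ∈ S) j ∈ X then 1 else 0 := by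
  rw [← Nat.count_succ, Nat.count_eq_card_filter_range, Nat.count_eq_card_filter_range]
  congr 1
  ext x
  simp only [Finset.mem_filter, Finset.mem_range]
  refine and_congr_left fun hx => ⟨fun h => ?_, fun h => ?_⟩
  · obtain ⟨i, hi, rfl⟩ := exists_nth_finset (hX hx)
    have h1 : i ≤ j := by
      by_contra h2
      rcases (Nat.succ_le_of_lt (not_le.1 h2)).lt_or_eq with h3 | h3
      · exact (nth_lt_nth_finset h3 hi).not_gt h
      · exact h.ne (by rw [← h3])
    rcases h1.lt_or_eq with h2 | rfl
    · exact (nth_lt_nth_finset h2 (by omega)).trans (Nat.lt_succ_self _)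
    · exact Nat.lt_succ_self _
  · exact (Nat.lt_succ_iff.1 h).trans_lt (nth_lt_nth_finset (Nat.lt_succ_self j) hj)

theorem count_nth_zero {X S : Finset ℕ} (hX : X ⊆ S) :
    Nat.count (· ∈ X) (Nat.nth (· ∈ S) 0) = 0 := by
  rw [Nat.count_eq_card_filter_range, Finset.card_eq_zero, Finset.filter_eq_empty_iff]
  intro x hx h
  obtain ⟨i, hi, rfl⟩ := exists_nth_finset (hX h)
  rw [Finset.mem_range] at hx
  rcases Nat.eq_zero_or_pos i with rfl | h0
  · exact hx.false
  · exact (nth_lt_nth_finset h0 hi).not_gt hx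

/-- Right neighbours of the elements of `X` below `x` are at most `x`. They are all below `x`,
except that `x` itself is one when its left neighbour is in `X`. -/
theorem count_eq_count_rightOf {X S : Finset ℕ} (hX : X ⊆ S) {x : ℕ} (hx : x ∈ S) :
    Nat.count (· ∈ X) x =
      Nat.count (· ∈ rightOf X S) x + if x ∈ rightOf X S then 1 else 0 := by
  obtain ⟨j, hj, rfl⟩ := exists_nth_finset hx
  clear hx
  induction j with
  | zero =>
    rw [count_nth_zero hX, count_nth_zero (rightOf_subset X S),
      if_neg (nth_zero_notMem_rightOf X S)]
  | succ j ih =>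
    rw [count_nth_succ hX hj, count_nth_succ (rightOf_subset X S) hj, ih (by omega)]
    simp only [nth_succ_mem_rightOf hj]

/-! ### From two rows to the three parts of a flag -/

/-- The triples of sets that are the first row, the second row and the part below of a standard
tableau of shape `(n - k, n - k, 1, …, 1)` with `k` ones. -/
structure IsFlagTriple (n k : ℕ) (P Q L : Finset ℕ) : Prop where
  card_fst : P.card = n - k
  card_snd : Q.card = n - k
  card_trd : L.card = k
  union : P ∪ Q ∪ L = Finset.Icc 1 (2 * n - k)
  count_lt : ∀ x ∈ Q, Nat.count (· ∈ Q) x < Nat.count (· ∈ P) x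
  count_pos : ∀ x ∈ L, 0 < Nat.count (· ∈ Q) x

/-- The last element of `S` has `n - 1` elements of `S` below it, hence all `n` elements of `R`, and
so is not itself in `R`. -/
theorem IsRowPair.nth_notMem {n m : ℕ} {R S : Finset ℕ} (h : IsRowPair n m R S) {j : ℕ}
    (hj : j + 1 = S.card) : Nat.nth (· ∈ S) j ∉ R ∩ S := by
  intro hx
  rw [Finset.mem_inter] at hx
  have h1 := h.count_lt _ hx.2
  rw [count_nth_finset (by omega)] at h1
  have h2 : Nat.count (· ∈ R) (Nat.nth (· ∈ S) j) < R.card := by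
    rw [Nat.count_eq_card_filter_range]
    refine Finset.card_lt_card ⟨fun x hx => (Finset.mem_filter.1 hx).2, fun hsub => ?_⟩
    exact (Finset.mem_range.1 (Finset.mem_filter.1 (hsub hx.1)).1).false
  have := h.card_left
  have := h.card_right
  omega

theorem IsRowPair.leftOf_eq {n m : ℕ} {R S : Finset ℕ} (h : IsRowPair n m R S) :
    leftOf (rightOf (R ∩ S) S) S = R ∩ S :=
  leftOf_rightOf Finset.inter_subset_right fun _ hj => h.nth_notMem hj

theorem IsRowPair.isFlagTriple {n k m : ℕ} {R S : Finset ℕ} (h : IsRowPair n m R S)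
    (hk : m + k = 2 * n) :
    IsFlagTriple n k (R \ (R ∩ S)) (S \ rightOf (R ∩ S) S) (rightOf (R ∩ S) S) := by
  have hA : R ∩ S ⊆ S := Finset.inter_subset_right
  have hA' : R ∩ S ⊆ R := Finset.inter_subset_left
  have hB := rightOf_subset (R ∩ S) S
  have hR := h.card_left
  have hS := h.card_right
  have cA : (R ∩ S).card = k := by
    have h1 := Finset.card_union_add_card_inter R S
    rw [h.union, Nat.card_Icc] at h1
    omega
  -- Neither neighbour operation increases cardinality, and here `leftOf` undoes `rightOf`.
  have cB : (rightOf (R ∩ S) S).card = k := by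
    have h1 := card_rightOf_le (R ∩ S) S
    have h2 := card_leftOf_le (rightOf (R ∩ S) S) S
    rw [h.leftOf_eq] at h2
    omega
  constructor
  · rw [Finset.card_sdiff_of_subset hA', hR, cA]
  · rw [Finset.card_sdiff_of_subset hB, hS, cB]
  · exact cB
  · rw [Finset.union_assoc, Finset.sdiff_union_of_subset hB, Finset.sdiff_inter_self_left,
      Finset.sdiff_union_self_eq_union, h.union, show 2 * n - k = m by omega]
  · intro x hx
    rw [Finset.mem_sdiff] at hx
    have h1 := count_sdiff_add hA' x
    have h2 := count_sdiff_add hB x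
    have h3 := count_eq_count_rightOf hA hx.1
    rw [if_neg hx.2] at h3
    have h4 := h.count_lt x hx.1
    omega
  · intro x hx
    obtain ⟨j, hj, -, rfl⟩ := mem_rightOf.1 hx
    refine (Nat.zero_le _).trans_lt (count_lt_count_of_mem (x := Nat.nth (· ∈ S) 0) ?_
      (nth_lt_nth_finset (Nat.succ_pos j) hj))
    exact Finset.mem_sdiff.2 ⟨nth_mem_finset (by omega), nth_zero_notMem_rightOf _ _⟩

theorem IsRowPair.eq_of_flag_eq {n m m' : ℕ} {R S R' S' : Finset ℕ} (h : IsRowPair n m R S)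
    (h' : IsRowPair n m' R' S') (h1 : R \ (R ∩ S) = R' \ (R' ∩ S'))
    (h2 : S \ rightOf (R ∩ S) S = S' \ rightOf (R' ∩ S') S')
    (h3 : rightOf (R ∩ S) S = rightOf (R' ∩ S') S') : R = R' ∧ S = S' := by
  have hS : S = S' := by
    rw [← Finset.sdiff_union_of_subset (rightOf_subset (R ∩ S) S), h2, h3,
      Finset.sdiff_union_of_subset (rightOf_subset (R' ∩ S') S')]
  have hA : R ∩ S = R' ∩ S' := by
    rw [← h.leftOf_eq, h3, hS, h'.leftOf_eq]
  refine ⟨?_, hS⟩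
  rw [← Finset.sdiff_union_of_subset (Finset.inter_subset_left : R ∩ S ⊆ R), h1, hA,
    Finset.sdiff_union_of_subset Finset.inter_subset_left]

/-- The three cardinalities add up to that of the union. -/
theorem IsFlagTriple.disjoint {n k : ℕ} {P Q L : Finset ℕ} (h : IsFlagTriple n k P Q L)
    (hk : k < n) : Disjoint P (Q ∪ L) ∧ Disjoint Q L := by
  have h1 := Finset.card_union_add_card_inter P (Q ∪ L)
  have h2 := Finset.card_union_add_card_inter Q L
  rw [← Finset.union_assoc, h.union, Nat.card_Icc, h.card_fst] at h1
  rw [h.card_snd, h.card_trd] at h2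
  rw [Finset.disjoint_iff_inter_eq_empty, Finset.disjoint_iff_inter_eq_empty,
    ← Finset.card_eq_zero, ← Finset.card_eq_zero]
  omega

/-- The second row must be `S = Q ∪ L`, the doubled numbers must be the left neighbours of `L` in
`S`, and the first row is `P` together with these. By `count_pos`, the first element of `S` is not
in `L`, so every element of `L` has a left neighbour. -/
theorem IsFlagTriple.exists_isRowPair {n k : ℕ} {P Q L : Finset ℕ} (h : IsFlagTriple n k P Q L)
    (hk : k < n) : ∃ R S, IsRowPair n (2 * n - k) R S ∧ R \ (R ∩ S) = P ∧
      S \ rightOf (R ∩ S) S = Q ∧ rightOf (R ∩ S) S = L := by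
  obtain ⟨d1, d2⟩ := h.disjoint hk
  have hP := h.card_fst
  have hQ := h.card_snd
  have hL := h.card_trd
  set S := Q ∪ L with hS
  have hLS : L ⊆ S := Finset.subset_union_right
  have hSL : S \ L = Q := by
    rw [hS, Finset.union_sdiff_right, Finset.sdiff_eq_self_of_disjoint d2]
  have cS : S.card = n := by rw [hS, Finset.card_union_of_disjoint d2]; omega
  have h0 : Nat.nth (· ∈ S) 0 ∉ L := by
    intro h1
    have h2 := h.count_pos _ h1
    rw [count_nth_zero Finset.subset_union_left] at h2
    exact h2.false
  have hA := leftOf_subset L S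
  have hr := rightOf_leftOf hLS h0
  have cA : (leftOf L S).card = k := by
    have h1 := card_leftOf_le L S
    have h2 := card_rightOf_le (leftOf L S) S
    rw [hr] at h2
    omega
  have dA : Disjoint P (leftOf L S) := Finset.disjoint_of_subset_right hA d1
  have hRS : (P ∪ leftOf L S) ∩ S = leftOf L S := by
    rw [Finset.union_inter_distrib_right, Finset.disjoint_iff_inter_eq_empty.1 d1,
      Finset.empty_union, Finset.inter_eq_left.2 hA]
  have hRA : (P ∪ leftOf L S) \ leftOf L S = P := by
    rw [Finset.union_sdiff_right, Finset.sdiff_eq_self_of_disjoint dA]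
  refine ⟨P ∪ leftOf L S, S, ⟨?_, cS, ?_, ?_⟩, ?_, ?_, ?_⟩
  · rw [Finset.card_union_of_disjoint dA]
    omega
  · rw [Finset.union_assoc, Finset.union_eq_right.2 hA, hS, ← Finset.union_assoc, h.union]
  · intro x hx
    have h1 := count_sdiff_add (Finset.subset_union_right : leftOf L S ⊆ P ∪ leftOf L S) x
    have h2 := count_sdiff_add hLS x
    have h3 := count_eq_count_rightOf hA hx
    rw [hRA] at h1
    rw [hSL] at h2
    rw [hr] at h3
    -- At `x ∈ L` there is one more doubled number below `x` than there are elements of `L`, so the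
    -- weak comparison of `Q` with `P` suffices.
    by_cases hxL : x ∈ L
    · rw [if_pos hxL] at h3
      have := count_le_count h.count_lt x
      omega
    · rw [if_neg hxL] at h3
      have := h.count_lt x ((Finset.mem_union.1 hx).resolve_right hxL)
      omega
  · rw [hRS, hRA]
  · rw [hRS, hr, hSL]
  · rw [hRS, hr]

theorem IsIncreasing.rightOfDoubled_eq {n : ℕ} {T : SemistandardYoungTableau (twoRow n)}
    (hT : IsIncreasing T) :
    rightOfDoubled T = rightOf (rowEntries T 0 ∩ rowEntries T 1) (rowEntries T 1) := by
  have hc := hT.isRowPair.card_right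
  ext x
  rw [mem_rightOf, rightOfDoubled, Finset.mem_image, hc]
  constructor
  · rintro ⟨⟨i, j⟩, h1, rfl⟩
    rw [Finset.mem_filter, YoungDiagram.mem_row_iff] at h1
    obtain ⟨⟨h2, rfl : i = 1⟩, h3, h4⟩ := h1
    dsimp only at h3 h4 ⊢
    have hj := (mem_twoRow.1 h2).2
    obtain ⟨j, rfl⟩ : ∃ i, j = i + 1 := ⟨j - 1, by omega⟩
    refine ⟨j, hj, ?_, hT.nth_rowEntries one_lt_two hj⟩
    rw [hT.nth_rowEntries one_lt_two (by omega)]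
    exact h4
  · rintro ⟨j, hj, h1, rfl⟩
    rw [hT.nth_rowEntries one_lt_two (by omega)] at h1
    refine ⟨(1, j + 1), ?_, (hT.nth_rowEntries one_lt_two hj).symm⟩
    rw [Finset.mem_filter, YoungDiagram.mem_row_iff]
    exact ⟨⟨mem_twoRow.2 ⟨one_lt_two, hj⟩, rfl⟩, Nat.succ_pos j, h1⟩

/-! ### Standard tableaux of shape `(n - k, n - k, 1, …, 1)` -/

theorem mem_flagShape {n k i j : ℕ} {h : k < n} :
    (i, j) ∈ flagShape n k h ↔ i < 2 ∧ j < n - k ∨ 2 ≤ i ∧ i < k + 2 ∧ j = 0 := by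
  rw [flagShape, YoungDiagram.mem_ofRowLens]
  simp only [List.length_cons, List.length_replicate]
  rcases i with _ | _ | i
  · simp
  · simp
  · simp

theorem cells_flagShape {n k : ℕ} (h : k < n) : (flagShape n k h).cells =
    Finset.range 2 ×ˢ Finset.range (n - k) ∪ Finset.Ico 2 (k + 2) ×ˢ {0} := by
  ext ⟨i, j⟩
  rw [YoungDiagram.mem_cells, mem_flagShape]
  simp [and_assoc, eq_comm]

theorem card_flagShape {n k : ℕ} (h : k < n) : (flagShape n k h).card = 2 * n - k := by
  rw [YoungDiagram.card, cells_flagShape, Finset.card_union_of_disjoint]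
  · simp
    omega
  · rw [Finset.disjoint_left]
    rintro ⟨i, j⟩ h1 h2
    simp at h1 h2
    omega

/-- A map from the cells onto a set of the same cardinality is injective. -/
theorem bijOn_iff_tabEntries {μ : YoungDiagram} (T : SemistandardYoungTableau μ) :
    Set.BijOn (fun c : ℕ × ℕ => T c.1 c.2) (μ.cells : Set (ℕ × ℕ)) (Set.Icc 1 μ.card) ↔
      tabEntries T = Finset.Icc 1 μ.card := by
  constructor
  · intro h
    apply Finset.coe_injective
    rw [tabEntries, Finset.coe_image, Finset.coe_Icc, h.image_eq]
  · intro h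
    have h1 : (fun c : ℕ × ℕ => T c.1 c.2) '' (μ.cells : Set (ℕ × ℕ)) = Set.Icc 1 μ.card := by
      rw [← Finset.coe_Icc, ← h, tabEntries, Finset.coe_image]
    refine ⟨Set.mapsTo_iff_image_subset.2 h1.subset, ?_, h1.superset⟩
    apply Finset.card_image_iff.1
    change (tabEntries T).card = _
    rw [h, Nat.card_Icc, Nat.add_sub_cancel]

theorem rowEntries_flagShape {n k r : ℕ} {h : k < n} (hr : r < 2)
    (T : SemistandardYoungTableau (flagShape n k h)) :
    rowEntries T r = (Finset.range (n - k)).image (T r) := by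
  ext x
  simp [mem_rowEntries, mem_flagShape, hr, hr.not_ge]

theorem lowerEntries_flagShape {n k : ℕ} {h : k < n}
    (T : SemistandardYoungTableau (flagShape n k h)) :
    lowerEntries T = (Finset.range k).image fun i => T (i + 2) 0 := by
  ext x
  simp only [lowerEntries, Finset.mem_image, Finset.mem_filter, YoungDiagram.mem_cells,
    Finset.mem_range]
  constructor
  · rintro ⟨⟨i, j⟩, ⟨h1, h2⟩, rfl⟩
    rw [mem_flagShape] at h1
    dsimp only at h2 ⊢
    obtain ⟨h3, rfl⟩ : i < k + 2 ∧ j = 0 := by omega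
    exact ⟨i - 2, by omega, by rw [Nat.sub_add_cancel h2]⟩
  · rintro ⟨i, hi, rfl⟩
    exact ⟨(i + 2, 0), ⟨mem_flagShape.2 (by omega), by simp⟩, rfl⟩

theorem tabEntries_flagShape {n k : ℕ} {h : k < n}
    (T : SemistandardYoungTableau (flagShape n k h)) :
    tabEntries T = rowEntries T 0 ∪ rowEntries T 1 ∪ lowerEntries T := by
  ext x
  rw [Finset.mem_union, Finset.mem_union, mem_rowEntries, mem_rowEntries, tabEntries, lowerEntries,
    Finset.mem_image, Finset.mem_image]
  constructor
  · rintro ⟨⟨i, j⟩, h1, rfl⟩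
    rcases i with _ | _ | i
    · exact Or.inl (Or.inl ⟨j, h1, rfl⟩)
    · exact Or.inl (Or.inr ⟨j, h1, rfl⟩)
    · exact Or.inr ⟨(i + 2, j), Finset.mem_filter.2 ⟨h1, by simp⟩, rfl⟩
  · rintro ((⟨j, h1, rfl⟩ | ⟨j, h1, rfl⟩) | ⟨c, h1, rfl⟩)
    · exact ⟨(0, j), h1, rfl⟩
    · exact ⟨(1, j), h1, rfl⟩
    · exact ⟨c, (Finset.mem_filter.1 h1).1, rfl⟩

section SYT

variable {n k : ℕ} {h : k < n}

theorem SYT.row_strict (T : SYT (flagShape n k h)) {r : ℕ} (hr : r < 2) :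
    ∀ i j, i < j → j < n - k → T.1 r i < T.1 r j := by
  intro i j hij hj
  have h1 : (r, i) ∈ flagShape n k h := mem_flagShape.2 (by omega)
  have h2 : (r, j) ∈ flagShape n k h := mem_flagShape.2 (by omega)
  refine (T.1.row_weak hij h2).lt_of_ne fun h3 => ?_
  have := T.2.injOn (x₁ := (r, i)) (x₂ := (r, j)) h1 h2 h3
  simp at this
  omega

theorem SYT.column_strict (T : SYT (flagShape n k h)) :
    ∀ i j, i < j → j < k → T.1 (i + 2) 0 < T.1 (j + 2) 0 :=
  fun i j hij hj => T.1.col_strict (by omega) (mem_flagShape.2 (by omega))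

theorem SYT.isFlagTriple (T : SYT (flagShape n k h)) :
    IsFlagTriple n k (rowEntries T.1 0) (rowEntries T.1 1) (lowerEntries T.1) where
  card_fst := by
    rw [rowEntries_flagShape two_pos]
    exact card_image_of_strictMono (T.row_strict two_pos)
  card_snd := by
    rw [rowEntries_flagShape one_lt_two]
    exact card_image_of_strictMono (T.row_strict one_lt_two)
  card_trd := by
    rw [lowerEntries_flagShape]
    exact card_image_of_strictMono T.column_strict
  union := by
    rw [← tabEntries_flagShape, (bijOn_iff_tabEntries T.1).1 T.2, card_flagShape]
  count_lt := by
    intro x hx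
    rw [rowEntries_flagShape one_lt_two] at hx ⊢
    obtain ⟨j, hj, rfl⟩ := Finset.mem_image.1 hx
    rw [Finset.mem_range] at hj
    rw [count_image_of_strictMono (T.row_strict one_lt_two) hj, rowEntries_flagShape two_pos]
    nth_rw 1 [← count_image_of_strictMono (T.row_strict two_pos) hj]
    exact count_lt_count_of_mem (Finset.mem_image_of_mem _ (Finset.mem_range.2 hj))
      (T.1.col_strict one_pos (mem_flagShape.2 (by omega)))
  count_pos := by
    intro x hx
    rw [lowerEntries_flagShape] at hx
    obtain ⟨i, hi, rfl⟩ := Finset.mem_image.1 hx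
    rw [Finset.mem_range] at hi
    refine (Nat.zero_le _).trans_lt (count_lt_count_of_mem (x := T.1 1 0) ?_
      (T.1.col_strict (by omega) (mem_flagShape.2 (by omega))))
    exact mem_rowEntries.2 ⟨0, mem_flagShape.2 (by omega), rfl⟩

theorem SYT.ext_parts {T T' : SYT (flagShape n k h)} (h0 : rowEntries T.1 0 = rowEntries T'.1 0)
    (h1 : rowEntries T.1 1 = rowEntries T'.1 1) (h2 : lowerEntries T.1 = lowerEntries T'.1) :
    T = T' := by
  apply Subtype.ext
  apply SemistandardYoungTableau.ext
  intro i j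
  by_cases hc : (i, j) ∈ flagShape n k h
  · rcases mem_flagShape.1 hc with ⟨hi, hj⟩ | ⟨hi, hi', rfl⟩
    · have hr : rowEntries T.1 i = rowEntries T'.1 i := by interval_cases i <;> assumption
      rw [rowEntries_flagShape hi, rowEntries_flagShape hi] at hr
      rw [← nth_image_of_strictMono (T.row_strict hi) hj, hr,
        nth_image_of_strictMono (T'.row_strict hi) hj]
    · obtain ⟨i, rfl⟩ : ∃ a, i = a + 2 := ⟨i - 2, by omega⟩
      have hi' : i < k := by omega
      rw [lowerEntries_flagShape, lowerEntries_flagShape] at h2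
      have h3 := nth_image_of_strictMono T.column_strict hi'
      rw [h2, nth_image_of_strictMono T'.column_strict hi'] at h3
      exact h3.symm
  · rw [T.1.zeros hc, T'.1.zeros hc]

theorem IsFlagTriple.exists_tableau {P Q L : Finset ℕ} (hF : IsFlagTriple n k P Q L) (h : k < n) :
    ∃ T : SYT (flagShape n k h),
      rowEntries T.1 0 = P ∧ rowEntries T.1 1 = Q ∧ lowerEntries T.1 = L := by
  have hP := hF.card_fst
  have hQ := hF.card_snd
  have hL := hF.card_trd
  let f : ℕ → ℕ → ℕ
    | 0, j => Nat.nth (· ∈ P) j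
    | 1, j => Nat.nth (· ∈ Q) j
    | i + 2, 0 => Nat.nth (· ∈ L) i
    | _ + 2, _ + 1 => 0
  have hPQ : ∀ j, j < n - k → f 0 j < f 1 j := fun j hj =>
    nth_lt_nth_of_count_lt hF.count_lt (by omega)
  -- Some element of `Q` lies below any given element of `L`, hence so does the least one.
  have hQL : ∀ i, i < k → f 1 0 < f (i + 2) 0 := fun i hi =>
    Nat.nth_lt_of_lt_count (hF.count_pos _ (nth_mem_finset (by omega)))
  let T : SemistandardYoungTableau (flagShape n k h) :=
    { entry := f
      row_weak' := by
        intro i j₁ j₂ h1 h2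
        rw [mem_flagShape] at h2
        obtain ⟨hi, hj⟩ : i < 2 ∧ j₂ < n - k := by omega
        interval_cases i
        · exact (nth_lt_nth_finset h1 (by omega)).le
        · exact (nth_lt_nth_finset h1 (by omega)).le
      col_strict' := by
        intro i₁ i₂ j h1 h2
        rcases mem_flagShape.1 h2 with ⟨h3, h4⟩ | ⟨h3, h4, rfl⟩
        · obtain ⟨rfl, rfl⟩ : i₁ = 0 ∧ i₂ = 1 := by omega
          exact hPQ j h4
        · obtain ⟨i₂, rfl⟩ : ∃ a, i₂ = a + 2 := ⟨i₂ - 2, by omega⟩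
          rcases i₁ with _ | _ | i₁
          · exact (hPQ 0 (by omega)).trans (hQL i₂ (by omega))
          · exact hQL i₂ (by omega)
          · exact nth_lt_nth_finset (by omega) (by omega)
      zeros' := by
        intro i j h1
        rw [mem_flagShape] at h1
        rcases i with _ | _ | i
        · exact nth_finset_eq_zero (by omega)
        · exact nth_finset_eq_zero (by omega)
        · rcases j with _ | j
          · exact nth_finset_eq_zero (by omega)
          · rfl }
  have hT0 : rowEntries T 0 = P := by
    rw [rowEntries_flagShape two_pos, ← hP]
    exact image_nth_finset P
  have hT1 : rowEntries T 1 = Q := by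
    rw [rowEntries_flagShape one_lt_two, ← hQ]
    exact image_nth_finset Q
  have hT2 : lowerEntries T = L := by
    rw [lowerEntries_flagShape]
    have h1 := image_nth_finset L
    rwa [hL] at h1
  refine ⟨⟨T, ?_⟩, hT0, hT1, hT2⟩
  rw [bijOn_iff_tabEntries, tabEntries_flagShape, hT0, hT1, hT2, hF.union, card_flagShape]

end SYT

theorem Inc.exists_flag {n k : ℕ} (h : k < n) (T : Inc (twoRow n) k) :
    ∃ S : SYT (flagShape n k h), IsFlagOf T.1 S.1 := by
  have h1 := T.2.2.trans (card_twoRow n)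
  obtain ⟨S, h2, h3, h4⟩ := (T.2.1.isRowPair.isFlagTriple h1).exists_tableau h
  exact ⟨S, h2, by rw [h3, T.2.1.rightOfDoubled_eq], by rw [h4, T.2.1.rightOfDoubled_eq]⟩

/-- The bijection from increasing tableaux of shape `2 × n` to standard tableaux of shape
`(n - k, n - k, 1, …, 1)`. -/
noncomputable def flagEquiv {n k : ℕ} (h : k < n) : Inc (twoRow n) k ≃ SYT (flagShape n k h) :=
  Equiv.ofBijective (fun T => (T.exists_flag h).choose) <| by
    constructor
    · intro T T' hS
      obtain ⟨a1, a2, a3⟩ := (T.exists_flag h).choose_spec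
      obtain ⟨b1, b2, b3⟩ := (T'.exists_flag h).choose_spec
      have hS' : (T.exists_flag h).choose = (T'.exists_flag h).choose := hS
      rw [hS'] at a1 a2 a3
      rw [a1] at b1
      rw [a2, T.2.1.rightOfDoubled_eq, T'.2.1.rightOfDoubled_eq] at b2
      rw [a3, T.2.1.rightOfDoubled_eq, T'.2.1.rightOfDoubled_eq] at b3
      obtain ⟨h0, h1⟩ := T.2.1.isRowPair.eq_of_flag_eq T'.2.1.isRowPair b1 b2 b3
      exact Subtype.ext (T.2.1.ext_rows T'.2.1 h0 h1)
    · intro S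
      obtain ⟨R, R', hR, h1, h2, h3⟩ := S.isFlagTriple.exists_isRowPair h
      obtain ⟨T, hT, hm, rfl, rfl⟩ := hR.exists_tableau
      refine ⟨⟨T, hT, by rw [hm, card_twoRow]; omega⟩, ?_⟩
      obtain ⟨a1, a2, a3⟩ :=
        (Inc.exists_flag h ⟨T, hT, by rw [hm, card_twoRow]; omega⟩).choose_spec
      rw [hT.rightOfDoubled_eq] at a2 a3
      -- A standard tableau of this shape is determined by its three parts, so the chosen flag of
      -- `T` is `S`.
      exact SYT.ext_parts (a1.trans h1) (a2.trans h2) (a3.trans h3)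

theorem isFlagOf_flagEquiv {n k : ℕ} (h : k < n) (T : Inc (twoRow n) k) :
    IsFlagOf T.1 (flagEquiv h T).1 :=
  (T.exists_flag h).choose_spec

theorem theorem1p1 :
    (∀ (n k : ℕ) (h : k < n),
      (∃ (e : Inc (twoRow n) k ≃ SchroderPathWith n k)
          (f : Inc (twoRow n) k ≃ SYT (flagShape n k h))
          (g : SchroderPathWith n k ≃ SYT (flagShape n k h)),
        (∀ T, (e T).1 = segments T.1) ∧
        (∀ T, IsFlagOf T.1 (f T).1) ∧
        (∀ T, g (e T) = f T)) ∧
      ∑ T : Inc (twoRow n) k, (RatFunc.X : RatFunc ℚ) ^ maj T.1 =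
        RatFunc.X ^ (n + (k + 1).choose 2) *
          (qBinom (n - 1) k * qBinom (2 * n - k) (n - k - 1) / qNum (n - k))) ∧
    (∀ n k : ℕ, 1 ≤ n → n ≤ k →
      IsEmpty (Inc (twoRow n) k) ∧ IsEmpty (SchroderPathWith n k)) ∧
    (∀ n : ℕ, Finite (IncTableau (twoRow n)) ∧ Finite (SchroderPath n) ∧
      Nat.card (IncTableau (twoRow n)) = schroderNumber n) := by
  refine ⟨fun n k h => ⟨⟨schroderEquivWith n k, flagEquiv h,
    (schroderEquivWith n k).symm.trans (flagEquiv h), fun T => rfl, isFlagOf_flagEquiv h,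
    fun T => by simp⟩, ?_⟩, fun n k hn hk => ?_, fun n => ?_⟩
  · rw [sum_maj_eq h, flagGF_square h]
  · have := isEmpty_schroderPathWith hn hk
    exact ⟨(schroderEquivWith n k).isEmpty, this⟩
  · have := finite_incTableau_twoRow n
    exact ⟨this, Finite.of_equiv _ (schroderEquiv n), Nat.card_congr (schroderEquiv n)⟩
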